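/- Let $\mathbb D$ be the open unit disc and, for $n\ge 0$ and $0\le k<2^n$, let $$T_{n,k}=\Bigl\{z=re^{it}\in\mathbb D:\ 2^{-(n+1)}<1-r\le 2^{-n},\ \frac{k}{2^n}\le\frac{t}{2\pi}<\frac{k+1}{2^n}\Bigr\}.$$ For a $\sigma$-finite, locally finite positive Borel measure $\mu$ on $\mathbb D$ put $\mu_{n,k}=\mu(T_{n,k})$, and let $\Lambda_\mu$ be the Poisson point process in $\mathbb D$ of intensity $\mu$: a random (finite or infinite) sequence of points of $\mathbb D$, repetitions allowed, such that for every Borel set $A\subset\mathbb D$ the number $N_A$ of its points in $A$, counted with multiplicity, is a Poisson random variable of parameter $\mu(A)$ (almost surely $+\infty$ if $\mu(A)=+\infty$), and $N_{A_1},\dots,N_{A_m}$ are independent whenever $A_1,\dots,A_m$ are pairwise disjoint Borel sets. For an arc $I$ of the unit circle with normalized length $|I|\in[0,1]$ let $Q(I)=\{z=re^{i\theta}\in\mathbb D: r>1-|I|,\ e^{i\theta}\in I\}$. For $\alpha\in(0,1]$, a sequence $\Lambda$ in $\mathbb D$ is $\alpha$-Carleson if there is $C>0$ such that $\sum_{\lambda\in\Lambda\cap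 Q(I)}(1-|\lambda|)^\alpha\le C|I|^\alpha$ for all arcs $I$ (points being counted with multiplicity). Then the following hold. (a) If $\sum_{n,k}\mu_{n,k}^\gamma<\infty$ for some $\gamma>1$, then almost surely $\Lambda_\mu$ is $1$-Carleson. If $\sum_{n,k}\mu_{n,k}^\gamma=\infty$ for every $\gamma>1$, then almost surely $\Lambda_\mu$ is not $1$-Carleson. (b) Let $\alpha\in(0,1)$. If $\sum_{n,k}\mu_{n,k}^\gamma<\infty$ for some $\gamma$ with $1<\gamma<\frac1{1-\alpha}$, then almost surely $\Lambda_\mu$ is $\alpha$-Carleson. (c) For every $\alpha\in(0,1)$ there is a $\sigma$-finite, locally finite positive Borel measure $\mu$ on $\mathbb D$ with $\mu(\mathbb D)=\infty$ such that $\sum_{n,k}\mu_{n,k}^{1/(1-\alpha)}<\infty$ and almost surely $\Lambda_\mu$ is not $\alpha$-Carleson. (d) For every $\gamma>1$ there is a $\sigma$-finite, locally finite positive Borel measure $\mu$ on $\mathbb D$ with $\mu(\mathbb D)=\infty$ such that $\sum_{n,k}\mu_{n,k}^{\gamma}=\infty$ and, for every $\alpha\in(0,1)$, almost surely $\Lambda_\mu$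 is $\alpha$-Carleson. -/

import Mathlib

open MeasureTheory ProbabilityTheory
open scoped ENNReal

universe u

/-- The open unit disc of `ℂ`, with its subspace topology and Borel σ-algebra. -/
abbrev Disc : Type := Metric.ball (0 : ℂ) 1

/-- The point `exp (2 π i t)` of the unit circle, the angle being measured in turns. -/
noncomputable def circlePoint (t : ℝ) : ℂ :=
  Complex.exp (2 * Real.pi * t * Complex.I)

/-- The dyadic box `T_{n,k}`: the points `z = r e^{iθ}` of the disc with
`2^{-(n+1)} < 1 - r ≤ 2^{-n}` and `k / 2^n ≤ θ / 2π < (k + 1) / 2^n`. -/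
def dyadicBox (n k : ℕ) : Set Disc :=
  {z | (1 / 2 : ℝ) ^ (n + 1) < 1 - ‖(z : ℂ)‖ ∧ 1 - ‖(z : ℂ)‖ ≤ (1 / 2 : ℝ) ^ n ∧
    ∃ t : ℝ, (k : ℝ) / 2 ^ n ≤ t ∧ t < ((k : ℝ) + 1) / 2 ^ n ∧
      (z : ℂ) = (‖(z : ℂ)‖ : ℂ) * circlePoint t}

/-- The sum `∑_{n ≥ 0} ∑_{0 ≤ k < 2^n} μ(T_{n,k})^γ`, with values in `[0, ∞]`. -/
noncomputable def dyadicSum (μ : Measure Disc) (γ : ℝ) : ℝ≥0∞ :=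
  ∑' n : ℕ, ∑ k : Fin (2 ^ n), μ (dyadicBox n k) ^ γ

/-- `I` is an arc (open, closed or half-open, possibly the whole circle) of the unit circle,
of normalized length `l`. -/
def IsArc (I : Set ℂ) (l : ℝ) : Prop :=
  0 ≤ l ∧ l ≤ 1 ∧ ∃ (a : ℝ) (J : Set ℝ),
    Set.Ioo a (a + l) ⊆ J ∧ J ⊆ Set.Icc a (a + l) ∧ I = circlePoint '' J

/-- The Carleson window `Q(I)` of an arc `I` of normalized length `l`: the points
`z = r e^{iθ}` of the disc with `r > 1 - l` and `e^{iθ} ∈ I`. -/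
def carlesonWindow (I : Set ℂ) (l : ℝ) : Set Disc :=
  {z | 1 - l < ‖(z : ℂ)‖ ∧ ∃ u ∈ I, (z : ℂ) = (‖(z : ℂ)‖ : ℂ) * u}

/-- A finite or infinite sequence of points of the disc, repetitions being allowed:
the points are `pt i`, for `i ∈ idx`. -/
structure PointSeq where
  /-- the set of indices in use -/
  idx : Set ℕ
  /-- the points (only the values at the indices in `idx` matter) -/
  pt : ℕ → Disc

namespace PointSeq

/-- The number of points of the sequence in `A`, counted with multiplicity. -/
noncomputable def count (Λ : PointSeq) (A : Set Disc) : ℕ∞ :=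
  {i | i ∈ Λ.idx ∧ Λ.pt i ∈ A}.encard

/-- The sum of `(1 - |λ|)^α` over the points `λ` of the sequence in `A`. -/
noncomputable def weight (Λ : PointSeq) (α : ℝ) (A : Set Disc) : ℝ≥0∞ :=
  ∑' i : {i // i ∈ Λ.idx ∧ Λ.pt i ∈ A}, ENNReal.ofReal ((1 - ‖(Λ.pt i : ℂ)‖) ^ α)

/-- The `α`-Carleson condition. -/
def IsCarleson (α : ℝ) (Λ : PointSeq) : Prop :=
  ∃ C : ℝ, 0 < C ∧ ∀ (I : Set ℂ) (l : ℝ), IsArc I l →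
    Λ.weight α (carlesonWindow I l) ≤ ENNReal.ofReal (C * l ^ α)

end PointSeq

/-- The random sequence `Λ`, defined on the probability space `(Ω, P)`, is a Poisson point process
in the disc with intensity `μ`. -/
structure IsPoissonProcess {Ω : Type u} [MeasurableSpace Ω] (P : Measure Ω)
    (Λ : Ω → PointSeq) (μ : Measure Disc) : Prop where
  /-- the counting variables are random variables -/
  measurable_count : ∀ A : Set Disc, MeasurableSet A → Measurable fun ω => (Λ ω).count A
  /-- the number of points in a set of finite intensity is Poisson distributed -/
  poisson : ∀ A : Set Disc, MeasurableSet A → μ A ≠ ∞ → ∀ k : ℕ,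
    P {ω | (Λ ω).count A = (k : ℕ∞)} = poissonMeasure (μ A).toNNReal {k}
  /-- a set of infinite intensity almost surely holds infinitely many points -/
  infinite : ∀ A : Set Disc, MeasurableSet A → μ A = ∞ → ∀ᵐ ω ∂P, (Λ ω).count A = ⊤
  /-- the numbers of points in pairwise disjoint sets are (mutually) independent -/
  indep : ∀ (m : ℕ) (A : Fin m → Set Disc), (∀ i, MeasurableSet (A i)) →
    (∀ i j, i ≠ j → Disjoint (A i) (A j)) →
      iIndepFun (fun i ω => (Λ ω).count (A i)) P

/-! Everything reduces to the counts `N_c` of points in the dyadic boxes, which are independent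
Poisson variables of mean `μ_c`. Up to a factor `2^α`, a point in a box of level `n` weighs
`2^(-αn)`.

Carleson side. A Carleson window is covered by two dyadic windows of comparable size, so it suffices
to bound uniformly in `b` the normalized window sum `S_b = ∑ 2^(-α(n_c - n_b)) N_c`, over the boxes
`c` below `b`. Since the coefficients are at most 1, Chernoff's bound gives `P(S_b > C) ≤ e (E
S_b)^C` (`measure_lt_tsum_le`). By Borel–Cantelli, `∑_b (E S_b)^C < ∞` for one `C > 0` is enough
(`ae_isCarleson`). For `C = γ > 1` with `(1 - α)γ < 1`, a Hardy-type inequality on the dyadic tree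
(`tsum_windowMass_rpow_ne_top`) deduces this from `∑ μ_c^γ < ∞`. This gives (b) and the first half
of (a).

Non-Carleson side. The 1-Carleson condition bounds the number of points in each single box, whereas
`∑ μ_c^M = ∞` forces, by independence, some box to hold at least `M` points
(`ae_exists_le_boxCount`). For (c), the masses `2^(-(1-α)n)/(n+1)` on all boxes of level `n` make
the mean total weight a harmonic series, and a weighted sum of infinite mean and coefficients at
most 1 is almost surely infinite (`ae_tsum_eq_top`).

For (d), the mass `(n+1)^(-1/γ)` is put on a single box per level. Then `E S_b` is comparably small,
and the criterion applies with the larger exponent `C = 2γ`. -/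

/-! ### The dyadic address of a point of the disc -/

/-- The index `n` of the dyadic annulus `2^{-(n+1)} < 1 - |z| ≤ 2^{-n}` containing `z`. -/
noncomputable def discLevel (z : Disc) : ℕ := Nat.log 2 ⌊1 / (1 - ‖(z : ℂ)‖)⌋₊

/-- The argument of `z` in turns, normalized to `[0, 1)`. -/
noncomputable def discAngle (z : Disc) : ℝ := Int.fract (Complex.arg z / (2 * Real.pi))

/-- The pair `(n, k)` such that `z` lies in the dyadic box `T_{n,k}`. -/
noncomputable def discCode (z : Disc) : ℕ × ℕ :=
  (discLevel z, ⌊(2 : ℝ) ^ discLevel z * discAngle z⌋₊)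

lemma norm_disc_lt_one (z : Disc) : ‖(z : ℂ)‖ < 1 := by
  exact mem_ball_zero_iff.1 z.2

lemma discAngle_nonneg (z : Disc) : 0 ≤ discAngle z := Int.fract_nonneg _

lemma discAngle_lt_one (z : Disc) : discAngle z < 1 := Int.fract_lt_one _

/-- The box condition reads `2^n ≤ 1/(1-|z|) < 2^(n+1)`; comparison with integers does not see the
difference between a real number and its floor. -/
lemma discLevel_eq_iff (z : Disc) (n : ℕ) :
    discLevel z = n ↔ (1 / 2 : ℝ) ^ (n + 1) < 1 - ‖(z : ℂ)‖ ∧ 1 - ‖(z : ℂ)‖ ≤ (1 / 2 : ℝ) ^ n := by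
  have h0 : 0 < 1 - ‖(z : ℂ)‖ := by linarith [norm_disc_lt_one z]
  have h1 : 1 ≤ 1 / (1 - ‖(z : ℂ)‖) := by
    rw [le_div_iff₀ h0]; linarith [norm_nonneg (z : ℂ)]
  have h2 : ⌊1 / (1 - ‖(z : ℂ)‖)⌋₊ ≠ 0 := (Nat.floor_pos.2 h1).ne'
  rw [discLevel, Nat.log_eq_iff (Or.inr ⟨one_lt_two, h2⟩), Nat.le_floor_iff (by positivity),
    Nat.floor_lt (by positivity), and_comm]
  push_cast
  rw [le_div_iff₀ h0, div_lt_iff₀ h0, one_div_pow, one_div_pow, div_lt_iff₀ (by positivity),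
    le_div_iff₀ (by positivity), mul_comm, mul_comm ((2 : ℝ) ^ n)]

lemma lt_one_sub_norm (z : Disc) : (1 / 2 : ℝ) ^ (discLevel z + 1) < 1 - ‖(z : ℂ)‖ :=
  ((discLevel_eq_iff z _).1 rfl).1

lemma one_sub_norm_le (z : Disc) : 1 - ‖(z : ℂ)‖ ≤ (1 / 2 : ℝ) ^ discLevel z :=
  ((discLevel_eq_iff z _).1 rfl).2

lemma circlePoint_eq_iff {s t : ℝ} : circlePoint s = circlePoint t ↔ ∃ m : ℤ, s = t + m := by
  rw [circlePoint, circlePoint, Complex.exp_eq_exp_iff_exists_int]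
  refine exists_congr fun m => ?_
  have : (2 * Real.pi * t * Complex.I + m * (2 * Real.pi * Complex.I) : ℂ)
      = 2 * Real.pi * ((t + m : ℝ) : ℂ) * Complex.I := by push_cast; ring
  have hpi : (2 * Real.pi : ℂ) ≠ 0 := by simp [Real.pi_ne_zero]
  rw [this, mul_left_inj' Complex.I_ne_zero, mul_right_inj' hpi, Complex.ofReal_inj]

lemma norm_circlePoint (t : ℝ) : ‖circlePoint t‖ = 1 := by
  have : (2 * Real.pi * t * Complex.I : ℂ) = ((2 * Real.pi * t : ℝ) : ℂ) * Complex.I := by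
    push_cast; ring
  rw [circlePoint, this, Complex.norm_exp_ofReal_mul_I]

lemma disc_eq_norm_mul_circlePoint (z : Disc) :
    (z : ℂ) = (‖(z : ℂ)‖ : ℂ) * circlePoint (discAngle z) := by
  have h : circlePoint (discAngle z) = circlePoint (Complex.arg z / (2 * Real.pi)) :=
    circlePoint_eq_iff.2 ⟨-⌊Complex.arg z / (2 * Real.pi)⌋, by
      rw [discAngle, Int.fract]; push_cast; ring⟩
  have h2 : (2 * Real.pi * ((Complex.arg z / (2 * Real.pi) : ℝ) : ℂ) * Complex.I : ℂ)
      = Complex.arg z * Complex.I := by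
    have hpi : (Real.pi : ℂ) ≠ 0 := by simp [Real.pi_ne_zero]
    push_cast; field_simp
  rw [h, circlePoint, h2, Complex.norm_mul_exp_arg_mul_I]

lemma discAngle_eq_fract {z : Disc} (hz : (z : ℂ) ≠ 0) {s : ℝ}
    (h : (z : ℂ) = (‖(z : ℂ)‖ : ℂ) * circlePoint s) : discAngle z = Int.fract s := by
  have h' := (disc_eq_norm_mul_circlePoint z).symm.trans h
  have hn : (‖(z : ℂ)‖ : ℂ) ≠ 0 := by simpa using hz
  obtain ⟨m, hm⟩ := circlePoint_eq_iff.1 (mul_left_cancel₀ hn h')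
  have : Int.fract (discAngle z) = Int.fract s := by rw [hm, Int.fract_add_intCast]
  rwa [Int.fract_eq_self.2 ⟨discAngle_nonneg z, discAngle_lt_one z⟩] at this

lemma discCode_snd_lt (z : Disc) : (discCode z).2 < 2 ^ (discCode z).1 := by
  rw [discCode, Nat.floor_lt (mul_nonneg (by positivity) (discAngle_nonneg z))]
  push_cast
  exact mul_lt_of_lt_one_right (by positivity) (discAngle_lt_one z)

lemma discCode_eq_iff (z : Disc) (n k : ℕ) : discCode z = (n, k) ↔
    discLevel z = n ∧ (k : ℝ) / 2 ^ n ≤ discAngle z ∧ discAngle z < ((k : ℝ) + 1) / 2 ^ n := by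
  rw [discCode, Prod.mk.injEq]
  refine and_congr_right fun h => ?_
  rw [h, Nat.floor_eq_iff (mul_nonneg (by positivity) (discAngle_nonneg z)),
    div_le_iff₀ (by positivity), lt_div_iff₀ (by positivity), mul_comm]

lemma discLevel_eq_zero_of_eq_zero {z : Disc} (hz : (z : ℂ) = 0) : discLevel z = 0 := by
  rw [discLevel_eq_iff, hz]; norm_num

lemma dyadicBox_eq_preimage {n k : ℕ} (hk : k < 2 ^ n) :
    dyadicBox n k = discCode ⁻¹' {(n, k)} := by
  ext z
  rw [Set.mem_preimage, Set.mem_singleton_iff, discCode_eq_iff, discLevel_eq_iff, and_assoc]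
  change _ ∧ _ ∧ _ ↔ _
  refine and_congr_right fun h1 => and_congr_right fun h2 => ⟨?_, fun h =>
    ⟨_, h.1, h.2, disc_eq_norm_mul_circlePoint z⟩⟩
  rintro ⟨t, h3, h4, h5⟩
  have hk' : (k : ℝ) + 1 ≤ 2 ^ n := by exact_mod_cast hk
  -- At the origin every angle `t` is admissible, but the origin only meets level 0, which has a
  -- single box.
  by_cases hz : (z : ℂ) = 0
  · have hn : n = 0 := ((discLevel_eq_iff z n).2 ⟨h1, h2⟩).symm.trans
      (discLevel_eq_zero_of_eq_zero hz)
    subst hn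
    obtain rfl : k = 0 := by simpa using hk
    simpa using ⟨discAngle_nonneg z, discAngle_lt_one z⟩
  · have : Int.fract t = t := Int.fract_eq_self.2
      ⟨le_trans (by positivity) h3, h4.trans_le (by rw [div_le_one (by positivity)]; exact hk')⟩
    rw [discAngle_eq_fract hz h5, this]
    exact ⟨h3, h4⟩

lemma measurable_discLevel : Measurable discLevel := by
  have h : Measurable fun z : Disc => 1 / (1 - ‖(z : ℂ)‖) := by fun_prop
  exact (measurable_of_countable (Nat.log 2)).comp (Nat.measurable_floor.comp h)

lemma measurable_discAngle : Measurable discAngle := by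
  have h : Measurable fun z : Disc => Complex.arg z / (2 * Real.pi) :=
    (Complex.measurable_arg.comp measurable_subtype_coe).div_const _
  exact measurable_fract.comp h

lemma measurable_discCode : Measurable discCode := by
  refine measurable_discLevel.prodMk (Nat.measurable_floor.comp ?_)
  exact ((measurable_of_countable fun n : ℕ => (2 : ℝ) ^ n).comp measurable_discLevel).mul
    measurable_discAngle

lemma measurableSet_discCode (s : Set (ℕ × ℕ)) : MeasurableSet (discCode ⁻¹' s) :=
  measurable_discCode s.to_countable.measurableSet

lemma discCode_preimage_eq_empty {n k : ℕ} (hk : 2 ^ n ≤ k) : discCode ⁻¹' {(n, k)} = ∅ := by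
  ext z
  simp only [Set.mem_preimage, Set.mem_singleton_iff, Set.mem_empty_iff_false, iff_false]
  intro h
  have := discCode_snd_lt z
  rw [h] at this
  exact absurd this (not_lt.2 hk)

/-- The intensity of the dyadic box with address `b`. -/
noncomputable def boxMass (μ : Measure Disc) (b : ℕ × ℕ) : ℝ≥0∞ := μ (discCode ⁻¹' {b})

/-- Addresses with `k ≥ 2^n` name no box; giving them mass zero allows sums over all of `ℕ × ℕ`. -/
lemma boxMass_eq_zero (μ : Measure Disc) {n k : ℕ} (hk : 2 ^ n ≤ k) : boxMass μ (n, k) = 0 := by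
  rw [boxMass, discCode_preimage_eq_empty hk, measure_empty]

lemma tsum_eq_tsum_sum_fin {f : ℕ × ℕ → ℝ≥0∞} (hf : ∀ n k, 2 ^ n ≤ k → f (n, k) = 0) :
    ∑' b, f b = ∑' n : ℕ, ∑ k : Fin (2 ^ n), f (n, k) := by
  rw [ENNReal.tsum_prod']
  refine tsum_congr fun n => ?_
  rw [tsum_eq_sum (s := Finset.range (2 ^ n)) (fun k hk => hf n k (by simpa using hk)),
    Finset.sum_range]

lemma dyadicSum_eq_tsum (μ : Measure Disc) {γ : ℝ} (hγ : 0 < γ) :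
    dyadicSum μ γ = ∑' b, boxMass μ b ^ γ := by
  rw [tsum_eq_tsum_sum_fin fun n k hk => by rw [boxMass_eq_zero μ hk, ENNReal.zero_rpow_of_pos hγ]]
  simp only [dyadicSum, boxMass]
  exact tsum_congr fun n => Finset.sum_congr rfl fun k _ => by rw [dyadicBox_eq_preimage k.2]

/-- The box lies in a closed disc of radius `1 - 2^(-(n+1))`, which is compact in the open disc. -/
lemma boxMass_lt_top (μ : Measure Disc) [IsLocallyFiniteMeasure μ] (b : ℕ × ℕ) :
    boxMass μ b < ∞ := by
  obtain ⟨n, k⟩ := b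
  have hK : IsCompact {z : Disc | ‖(z : ℂ)‖ ≤ 1 - (1 / 2 : ℝ) ^ (n + 1)} := by
    rw [Subtype.isCompact_iff]
    convert isCompact_closedBall (0 : ℂ) (1 - (1 / 2 : ℝ) ^ (n + 1)) using 1
    ext z
    simp only [Set.mem_image, Set.mem_ofPred_eq, Metric.mem_closedBall, dist_zero_right]
    constructor
    · rintro ⟨w, hw, rfl⟩; exact hw
    · intro h
      refine ⟨⟨z, ?_⟩, h, rfl⟩
      have : (0 : ℝ) < (1 / 2) ^ (n + 1) := by positivity
      simp only [Metric.mem_ball, dist_zero_right]; linarith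
  refine (measure_mono ?_).trans_lt hK.measure_lt_top
  intro z hz
  have := lt_one_sub_norm z
  rw [((discCode_eq_iff z n k).1 hz).1] at this
  simp only [Set.mem_ofPred_eq]; linarith

/-! ### Weights of a sequence in terms of its dyadic counts -/

namespace PointSeq

/-- The number of points in the dyadic box with address `b`. -/
noncomputable def boxCount (Λ : PointSeq) (b : ℕ × ℕ) : ℕ∞ := Λ.count (discCode ⁻¹' {b})

lemma weight_eq_tsum (Λ : PointSeq) (α : ℝ) (A : Set Disc) :
    Λ.weight α A = ∑' b, ∑' i : {i // i ∈ Λ.idx ∧ Λ.pt i ∈ A ∩ discCode ⁻¹' {b}},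
      ENNReal.ofReal ((1 - ‖(Λ.pt i : ℂ)‖) ^ α) := by
  classical
  have h (B : Set Disc) : ∑' i : {i // i ∈ Λ.idx ∧ Λ.pt i ∈ B},
      ENNReal.ofReal ((1 - ‖(Λ.pt i : ℂ)‖) ^ α) = ∑' i, if i ∈ Λ.idx ∧ Λ.pt i ∈ B then
        ENNReal.ofReal ((1 - ‖(Λ.pt i : ℂ)‖) ^ α) else 0 := by
    refine (tsum_subtype {i | i ∈ Λ.idx ∧ Λ.pt i ∈ B}
      fun i => ENNReal.ofReal ((1 - ‖(Λ.pt i : ℂ)‖) ^ α)).trans ?_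
    exact tsum_congr fun i => by simp [Set.indicator]
  simp_rw [weight, h]
  rw [ENNReal.tsum_comm]
  refine tsum_congr fun i => ?_
  rw [tsum_eq_single (discCode (Λ.pt i))]
  · simp
  · intro b hb
    rw [if_neg]
    rintro ⟨-, -, h⟩
    exact hb (Set.mem_singleton_iff.1 h).symm

lemma tsum_const_eq_count_mul (Λ : PointSeq) (B : Set Disc) (c : ℝ≥0∞) :
    ∑' _ : {i // i ∈ Λ.idx ∧ Λ.pt i ∈ B}, c = (Λ.count B : ℝ≥0∞) * c :=
  ENNReal.tsum_set_const _ c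

lemma count_mono (Λ : PointSeq) {A B : Set Disc} (h : A ⊆ B) : Λ.count A ≤ Λ.count B :=
  Set.encard_le_encard fun _ hi => ⟨hi.1, h hi.2⟩

end PointSeq

lemma ofReal_half_pow_rpow (n : ℕ) {α : ℝ} (hα : 0 < α) :
    ENNReal.ofReal (((1 / 2 : ℝ) ^ n) ^ α) = ((2⁻¹ : ℝ≥0∞) ^ α) ^ n := by
  rw [← ENNReal.ofReal_rpow_of_nonneg (by positivity) hα.le, ENNReal.ofReal_pow (by positivity),
    ← ENNReal.rpow_natCast, ← ENNReal.rpow_natCast, ← ENNReal.rpow_mul, ← ENNReal.rpow_mul,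
    mul_comm, one_div, ENNReal.ofReal_inv_of_pos two_pos, ENNReal.ofReal_ofNat]

namespace PointSeq

lemma weight_le (Λ : PointSeq) {α : ℝ} (hα : 0 < α) (A : Set Disc) (S : Set (ℕ × ℕ))
    (hS : A ⊆ discCode ⁻¹' S) : Λ.weight α A ≤
      ∑' b, S.indicator (fun b => ((2⁻¹ : ℝ≥0∞) ^ α) ^ b.1 * (Λ.boxCount b : ℝ≥0∞)) b := by
  rw [weight_eq_tsum]
  refine ENNReal.tsum_le_tsum fun b => ?_
  by_cases hb : b ∈ S
  · rw [Set.indicator_of_mem hb]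
    calc _ ≤ ∑' i : {i // i ∈ Λ.idx ∧ Λ.pt i ∈ A ∩ discCode ⁻¹' {b}},
          ((2⁻¹ : ℝ≥0∞) ^ α) ^ b.1 := by
          refine ENNReal.tsum_le_tsum fun i => ?_
          rw [← ofReal_half_pow_rpow b.1 hα]
          refine ENNReal.ofReal_le_ofReal (Real.rpow_le_rpow ?_ ?_ hα.le)
          · linarith [norm_disc_lt_one (Λ.pt i)]
          · have h := one_sub_norm_le (Λ.pt i)
            have h2 : discCode (Λ.pt i) = b := i.2.2.2
            rwa [show discLevel (Λ.pt i) = b.1 from congrArg Prod.fst h2] at h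
      _ = Λ.count (A ∩ discCode ⁻¹' {b}) * ((2⁻¹ : ℝ≥0∞) ^ α) ^ b.1 :=
          tsum_const_eq_count_mul _ _ _
      _ ≤ _ := by
          rw [mul_comm]
          gcongr
          exact Λ.count_mono Set.inter_subset_right
  · have : IsEmpty {i // i ∈ Λ.idx ∧ Λ.pt i ∈ A ∩ discCode ⁻¹' {b}} := by
      refine ⟨fun i => hb ?_⟩
      have h2 : discCode (Λ.pt i) = b := i.2.2.2
      exact h2 ▸ hS i.2.2.1
    simp

lemma le_weight (Λ : PointSeq) {α : ℝ} (hα : 0 < α) (A : Set Disc) (S : Set (ℕ × ℕ))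
    (hS : discCode ⁻¹' S ⊆ A) :
    ∑' b, S.indicator (fun b => ((2⁻¹ : ℝ≥0∞) ^ α) ^ (b.1 + 1) * (Λ.boxCount b : ℝ≥0∞)) b ≤
      Λ.weight α A := by
  rw [weight_eq_tsum]
  refine ENNReal.tsum_le_tsum fun b => ?_
  by_cases hb : b ∈ S
  · rw [Set.indicator_of_mem hb]
    calc _ = Λ.count (A ∩ discCode ⁻¹' {b}) * ((2⁻¹ : ℝ≥0∞) ^ α) ^ (b.1 + 1) := by
          rw [mul_comm, Set.inter_eq_right.2]
          · rfl
          · exact (Set.preimage_mono (Set.singleton_subset_iff.2 hb)).trans hS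
      _ = ∑' i : {i // i ∈ Λ.idx ∧ Λ.pt i ∈ A ∩ discCode ⁻¹' {b}},
          ((2⁻¹ : ℝ≥0∞) ^ α) ^ (b.1 + 1) := (tsum_const_eq_count_mul _ _ _).symm
      _ ≤ _ := by
          refine ENNReal.tsum_le_tsum fun i => ?_
          rw [← ofReal_half_pow_rpow (b.1 + 1) hα]
          refine ENNReal.ofReal_le_ofReal (Real.rpow_le_rpow (by positivity) ?_ hα.le)
          have h := lt_one_sub_norm (Λ.pt i)
          have h2 : discCode (Λ.pt i) = b := i.2.2.2
          rw [show discLevel (Λ.pt i) = b.1 from congrArg Prod.fst h2] at h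
          exact h.le
  · rw [Set.indicator_of_notMem hb]; exact zero_le

end PointSeq

/-! ### Dyadic windows -/

/-- The addresses of the dyadic boxes contained in the dyadic window over the arc
`[k / 2^n, (k + 1) / 2^n)`, where `b = (n, k)`. -/
def dyadicBelow (b : ℕ × ℕ) : Set (ℕ × ℕ) := {c | b.1 ≤ c.1 ∧ c.2 / 2 ^ (c.1 - b.1) = b.2}

open Classical in
/-- The weight of a box of address `c` in the dyadic window of address `b`. -/
noncomputable def windowWeight (q : ℝ≥0∞) (b c : ℕ × ℕ) : ℝ≥0∞ :=
  if c ∈ dyadicBelow b then q ^ (c.1 - b.1) else 0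

lemma discCode_mem_dyadicBelow {z : Disc} {n k : ℕ} (hn : n ≤ discLevel z)
    (hk : ⌊(2 : ℝ) ^ n * discAngle z⌋₊ = k) : discCode z ∈ dyadicBelow (n, k) := by
  refine ⟨hn, ?_⟩
  change ⌊(2 : ℝ) ^ discLevel z * discAngle z⌋₊ / 2 ^ (discLevel z - n) = k
  rw [← hk, ← Nat.floor_div_natCast]
  congr 1
  push_cast
  rw [div_eq_iff (by positivity), mul_right_comm, ← pow_add, Nat.add_sub_cancel' hn]

/-- Choose `n` with `2^(-(n+1)) < l ≤ 2^(-n)`. The arc then meets at most two consecutive dyadic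
arcs of generation `n`, and the points of the window have level at least `n`. -/
lemma carlesonWindow_subset {I : Set ℂ} {l : ℝ} (h : IsArc I l) (hl : 0 < l) :
    ∃ n k₁ k₂ : ℕ, (1 / 2 : ℝ) ^ n ≤ 2 * l ∧
      carlesonWindow I l ⊆ discCode ⁻¹' (dyadicBelow (n, k₁) ∪ dyadicBelow (n, k₂)) := by
  obtain ⟨-, hl1, a, J, -, hJ, rfl⟩ := h
  obtain ⟨n, hn1, hn2⟩ := exists_nat_pow_near_of_lt_one hl hl1 (by norm_num : (0 : ℝ) < 1 / 2)
    (by norm_num)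
  have h2n : (0 : ℝ) < 2 ^ n := by positivity
  -- Reduction modulo `2^n` accounts for arcs that cross angle 0, and for arbitrary real `a`.
  refine ⟨n, (⌊(2 : ℝ) ^ n * a⌋ % 2 ^ n).toNat, ((⌊(2 : ℝ) ^ n * a⌋ + 1) % 2 ^ n).toNat, ?_, ?_⟩
  · rw [pow_succ] at hn1; linarith
  rintro z ⟨hz1, _, ⟨s, hs, rfl⟩, hz2⟩
  have hz : (z : ℂ) ≠ 0 := by
    intro h0
    rw [h0, norm_zero] at hz1
    linarith
  have hlev : n ≤ discLevel z := by
    have h1 := lt_one_sub_norm z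
    have h2 : (1 / 2 : ℝ) ^ (discLevel z + 1) < (1 / 2) ^ n := by linarith
    have := (pow_lt_pow_iff_right_of_lt_one₀ (by norm_num : (0 : ℝ) < 1 / 2) (by norm_num)).1 h2
    omega
  have hfl : ⌊(2 : ℝ) ^ n * discAngle z⌋₊ = (⌊(2 : ℝ) ^ n * s⌋ % 2 ^ n).toNat := by
    have h1 : ⌊(2 : ℝ) ^ n * discAngle z⌋ = ⌊(2 : ℝ) ^ n * s⌋ - 2 ^ n * ⌊s⌋ := by
      rw [discAngle_eq_fract hz hz2, Int.fract, mul_sub]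
      have : (2 : ℝ) ^ n * (⌊s⌋ : ℝ) = ((2 ^ n * ⌊s⌋ : ℤ) : ℝ) := by push_cast; rfl
      rw [this, Int.floor_sub_intCast]
    have h2 : 0 ≤ ⌊(2 : ℝ) ^ n * discAngle z⌋ :=
      Int.floor_nonneg.2 (mul_nonneg h2n.le (discAngle_nonneg z))
    have h3 : ⌊(2 : ℝ) ^ n * discAngle z⌋ < 2 ^ n := by
      rw [Int.floor_lt]
      push_cast
      exact mul_lt_of_lt_one_right h2n (discAngle_lt_one z)
    rw [← Int.floor_toNat]
    congr 1
    rw [← Int.emod_eq_of_lt h2 h3, h1, Int.sub_mul_emod_self_left]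
  have hs' := hJ hs
  have h4 : ⌊(2 : ℝ) ^ n * a⌋ ≤ ⌊(2 : ℝ) ^ n * s⌋ :=
    Int.floor_le_floor (by gcongr; exact hs'.1)
  have h5 : ⌊(2 : ℝ) ^ n * s⌋ ≤ ⌊(2 : ℝ) ^ n * a⌋ + 1 := by
    rw [← Int.floor_add_one]
    refine Int.floor_le_floor ?_
    have : (2 : ℝ) ^ n * s ≤ 2 ^ n * (a + (1 / 2) ^ n) := by
      gcongr; linarith [hs'.2]
    rwa [mul_add, ← mul_pow, mul_one_div_cancel two_ne_zero, one_pow] at this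
  rcases (by omega : ⌊(2 : ℝ) ^ n * s⌋ = ⌊(2 : ℝ) ^ n * a⌋ ∨
    ⌊(2 : ℝ) ^ n * s⌋ = ⌊(2 : ℝ) ^ n * a⌋ + 1) with h6 | h6
  · exact Or.inl (discCode_mem_dyadicBelow hlev (by rw [hfl, h6]))
  · exact Or.inr (discCode_mem_dyadicBelow hlev (by rw [hfl, h6]))

namespace PointSeq

/-- The normalized weight of the dyadic window with address `b`. -/
noncomputable def windowSum (Λ : PointSeq) (q : ℝ≥0∞) (b : ℕ × ℕ) : ℝ≥0∞ :=
  ∑' c, windowWeight q b c * (Λ.boxCount c : ℝ≥0∞)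

lemma tsum_indicator_dyadicBelow (Λ : PointSeq) (q : ℝ≥0∞) (b : ℕ × ℕ) :
    ∑' c, (dyadicBelow b).indicator (fun c => q ^ c.1 * (Λ.boxCount c : ℝ≥0∞)) c =
      q ^ b.1 * Λ.windowSum q b := by
  rw [windowSum, ← ENNReal.tsum_mul_left]
  refine tsum_congr fun c => ?_
  by_cases h : c ∈ dyadicBelow b
  · rw [Set.indicator_of_mem h, windowWeight, if_pos h, ← mul_assoc, ← pow_add,
      Nat.add_sub_cancel' h.1]
  · rw [Set.indicator_of_notMem h, windowWeight, if_neg h, zero_mul, mul_zero]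

lemma isCarleson_of_windowSum_le (Λ : PointSeq) {α : ℝ} (hα : 0 < α) {M : ℝ} (hM : 0 ≤ M)
    (h : ∀ b, Λ.windowSum ((2⁻¹ : ℝ≥0∞) ^ α) b ≤ ENNReal.ofReal M) : Λ.IsCarleson α := by
  -- Two dyadic windows, each of weight at most `(2l)^α M`; the `+ 1` keeps the constant positive
  -- when `M = 0`.
  refine ⟨2 ^ α * (2 * M) + 1, by positivity, fun I l hI => ?_⟩
  rcases hI.1.eq_or_lt with rfl | hl
  · have : carlesonWindow I 0 = ∅ := by
      ext z
      simp only [carlesonWindow, Set.mem_ofPred_eq, Set.mem_empty_iff_false, iff_false, not_and]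
      intro h1
      linarith [norm_disc_lt_one z]
    have h0 : IsEmpty {i // i ∈ Λ.idx ∧ Λ.pt i ∈ (∅ : Set Disc)} := ⟨fun i => i.2.2⟩
    rw [this, weight, tsum_empty]
    exact zero_le
  obtain ⟨n, k₁, k₂, hn, hsub⟩ := carlesonWindow_subset hI hl
  have hnl : ((2⁻¹ : ℝ≥0∞) ^ α) ^ n ≤ ENNReal.ofReal ((2 * l) ^ α) := by
    rw [← ofReal_half_pow_rpow n hα]
    exact ENNReal.ofReal_le_ofReal (Real.rpow_le_rpow (by positivity) hn hα.le)
  calc Λ.weight α (carlesonWindow I l) ≤ _ := Λ.weight_le hα _ _ hsub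
    _ ≤ ∑' c, ((dyadicBelow (n, k₁)).indicator
          (fun c => ((2⁻¹ : ℝ≥0∞) ^ α) ^ c.1 * (Λ.boxCount c : ℝ≥0∞)) c +
        (dyadicBelow (n, k₂)).indicator
          (fun c => ((2⁻¹ : ℝ≥0∞) ^ α) ^ c.1 * (Λ.boxCount c : ℝ≥0∞)) c) :=
        ENNReal.tsum_le_tsum fun c => by
          by_cases h1 : c ∈ dyadicBelow (n, k₁) <;> by_cases h2 : c ∈ dyadicBelow (n, k₂) <;>
            simp [Set.indicator, h1, h2]
    _ = ((2⁻¹ : ℝ≥0∞) ^ α) ^ n * (Λ.windowSum ((2⁻¹ : ℝ≥0∞) ^ α) (n, k₁) +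
        Λ.windowSum ((2⁻¹ : ℝ≥0∞) ^ α) (n, k₂)) := by
        rw [ENNReal.tsum_add, tsum_indicator_dyadicBelow, tsum_indicator_dyadicBelow, mul_add]
    _ ≤ ENNReal.ofReal ((2 * l) ^ α) * (ENNReal.ofReal M + ENNReal.ofReal M) := by
        gcongr
        · exact h _
        · exact h _
    _ = ENNReal.ofReal ((2 * l) ^ α * (M + M)) := by
        rw [ENNReal.ofReal_mul (by positivity), ENNReal.ofReal_add hM hM]
    _ ≤ _ := by
        refine ENNReal.ofReal_le_ofReal ?_
        rw [Real.mul_rpow two_pos.le hl.le]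
        nlinarith [Real.rpow_nonneg hl.le α]

end PointSeq

/-! ### Dyadic counts of a Poisson process -/

/-- The Poisson generating function, used with `x > 1` for upper tails and with `x < 1` for lower
tails. -/
lemma lintegral_pow_poissonMeasure (r x : NNReal) :
    ∫⁻ k, (x : ℝ≥0∞) ^ k ∂poissonMeasure r = ENNReal.ofReal (Real.exp (r * (x - 1))) := by
  rw [lintegral_countable']
  have h : HasSum (fun k : ℕ => (x : ℝ) ^ k * (Real.exp (-r) * r ^ k / k.factorial))
      (Real.exp (r * (x - 1))) := by
    have h1 := (NormedSpace.expSeries_div_hasSum_exp ((r : ℝ) * x)).mul_left (Real.exp (-r))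
    rw [← Real.exp_eq_exp_ℝ, ← Real.exp_add] at h1
    rw [show (r : ℝ) * (x - 1) = -r + r * x by ring]
    refine h1.congr_fun fun k => ?_
    rw [mul_pow]; ring
  rw [← h.tsum_eq, ENNReal.ofReal_tsum_of_nonneg (fun k => by positivity) h.summable]
  refine tsum_congr fun k => ?_
  rw [poissonMeasure_singleton, ENNReal.ofReal_mul (by positivity), ENNReal.ofReal_pow x.coe_nonneg,
    ENNReal.ofReal_coe_nnreal, mul_comm]

/-- Because the inequality is strict, the event is the increasing union of the corresponding events
for finite partial sums. -/
lemma measure_lt_tsum_le_of_finset {Ω : Type u} [MeasurableSpace Ω] {P : Measure Ω}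
    {Λ : Ω → PointSeq} (c : ℕ × ℕ → ℝ≥0∞) (K B : ℝ≥0∞)
    (hF : ∀ F : Finset (ℕ × ℕ), P {ω | K < ∑ b ∈ F, c b * ((Λ ω).boxCount b : ℝ≥0∞)} ≤ B) :
    P {ω | K < ∑' b, c b * ((Λ ω).boxCount b : ℝ≥0∞)} ≤ B := by
  have : {ω | K < ∑' b, c b * ((Λ ω).boxCount b : ℝ≥0∞)} =
      ⋃ F : Finset (ℕ × ℕ), {ω | K < ∑ b ∈ F, c b * ((Λ ω).boxCount b : ℝ≥0∞)} := by
    ext ω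
    simp only [ENNReal.tsum_eq_iSup_sum, lt_iSup_iff, Set.mem_iUnion, Set.mem_ofPred_eq]
  rw [this, Directed.measure_iUnion]
  · exact iSup_le hF
  · refine Monotone.directed_le fun F G hFG ω hω => ?_
    exact lt_of_lt_of_le (Set.mem_ofPred_eq ▸ hω) (Finset.sum_le_sum_of_subset hFG)

lemma lintegral_id_poissonMeasure (r : NNReal) :
    ∫⁻ k, (k : ℝ≥0∞) ∂poissonMeasure r = r := by
  rw [lintegral_countable', tsum_eq_zero_add' ENNReal.summable, Nat.cast_zero, zero_mul, zero_add]
  have h : ∀ k : ℕ, ((k + 1 : ℕ) : ℝ≥0∞) * poissonMeasure r {k + 1} = r * poissonMeasure r {k} := by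
    intro k
    rw [poissonMeasure_singleton, poissonMeasure_singleton, ← ENNReal.ofReal_natCast,
      ← ENNReal.ofReal_mul (by positivity), ← ENNReal.ofReal_coe_nnreal (p := r),
      ← ENNReal.ofReal_mul (by positivity), Nat.factorial_succ, pow_succ]
    congr 1
    push_cast
    have : (k : ℝ) + 1 ≠ 0 := by positivity
    field_simp
  simp_rw [h]
  rw [ENNReal.tsum_mul_left]
  have := lintegral_countable' (μ := poissonMeasure r) fun _ => 1
  rw [lintegral_one, measure_univ] at this
  simp only [one_mul] at this
  rw [← this, mul_one]

namespace IsPoissonProcess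

variable {Ω : Type u} [MeasurableSpace Ω] {P : Measure Ω}
  {Λ : Ω → PointSeq} {μ : Measure Disc}

lemma measurable_boxCount (h : IsPoissonProcess P Λ μ) (b : ℕ × ℕ) :
    Measurable fun ω => (Λ ω).boxCount b :=
  h.measurable_count _ (measurableSet_discCode {b})

lemma iIndepFun_boxCount (h : IsPoissonProcess P Λ μ) :
    iIndepFun (fun b ω => (Λ ω).boxCount b) P := by
  rw [iIndepFun_iff_finset]
  intro s
  have h1 := h.indep s.card (fun i => discCode ⁻¹' {(s.equivFin.symm i : ℕ × ℕ)})
    (fun i => measurableSet_discCode _) (fun i j hij => by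
      refine Disjoint.preimage _ (Set.disjoint_singleton.2 fun h => hij ?_)
      exact s.equivFin.symm.injective (Subtype.ext h))
  have h2 := h1.precomp s.equivFin.injective
  simp only [Equiv.symm_apply_apply] at h2
  exact h2

lemma measure_boxCount_eq (h : IsPoissonProcess P Λ μ) {b : ℕ × ℕ} (hb : boxMass μ b ≠ ∞) (k : ℕ) :
    P {ω | (Λ ω).boxCount b = (k : ℕ∞)} = poissonMeasure (boxMass μ b).toNNReal {k} :=
  h.poisson _ (measurableSet_discCode {b}) hb k

lemma measurable_toNat_boxCount (h : IsPoissonProcess P Λ μ) (b : ℕ × ℕ) :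
    Measurable fun ω => ((Λ ω).boxCount b).toNat :=
  (measurable_of_countable ENat.toNat).comp (h.measurable_boxCount b)

variable [IsProbabilityMeasure P]

/-- The Poisson probabilities of the finite values already add up to 1. -/
lemma ae_boxCount_ne_top (h : IsPoissonProcess P Λ μ) {b : ℕ × ℕ} (hb : boxMass μ b ≠ ∞) :
    ∀ᵐ ω ∂P, (Λ ω).boxCount b ≠ ⊤ := by
  have hm : ∀ k : ℕ∞, MeasurableSet {ω | (Λ ω).boxCount b = k} := fun k =>
    h.measurable_boxCount b (measurableSet_singleton k)
  have h1 : P (⋃ k : ℕ, {ω | (Λ ω).boxCount b = (k : ℕ∞)}) = 1 := by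
    rw [measure_iUnion]
    · simp_rw [h.measure_boxCount_eq hb]
      have := lintegral_countable' (μ := poissonMeasure (boxMass μ b).toNNReal) fun _ => 1
      rw [lintegral_one, measure_univ] at this
      rw [this]
      simp
    · intro i j hij
      refine Set.disjoint_left.2 fun ω h1 h2 => hij ?_
      exact Nat.cast_injective (h1.symm.trans h2)
    · exact fun k => hm k
  have h2 : ∀ᵐ ω ∂P, ω ∈ ⋃ k : ℕ, {ω | (Λ ω).boxCount b = (k : ℕ∞)} :=
    (mem_ae_iff_prob_eq_one (MeasurableSet.iUnion fun k : ℕ => hm k)).2 h1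
  filter_upwards [h2] with ω hω
  obtain ⟨k, hk⟩ := Set.mem_iUnion.1 hω
  rw [show (Λ ω).boxCount b = (k : ℕ∞) from hk]
  exact ENat.natCast_ne_top k

lemma map_toNat_boxCount (h : IsPoissonProcess P Λ μ) {b : ℕ × ℕ} (hb : boxMass μ b ≠ ∞) :
    P.map (fun ω => ((Λ ω).boxCount b).toNat) = poissonMeasure (boxMass μ b).toNNReal := by
  refine Measure.ext_of_singleton fun k => ?_
  rw [Measure.map_apply (h.measurable_toNat_boxCount b) (measurableSet_singleton k),
    ← h.measure_boxCount_eq hb]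
  refine measure_congr ?_
  filter_upwards [h.ae_boxCount_ne_top hb] with ω hω
  refine propext ?_
  change ((Λ ω).boxCount b).toNat = k ↔ (Λ ω).boxCount b = k
  lift (Λ ω).boxCount b to ℕ using hω with m
  simp

lemma lintegral_boxCount (h : IsPoissonProcess P Λ μ) {b : ℕ × ℕ} (hb : boxMass μ b ≠ ∞) :
    ∫⁻ ω, ((Λ ω).boxCount b : ℝ≥0∞) ∂P = boxMass μ b := by
  have h1 := lintegral_id_poissonMeasure (boxMass μ b).toNNReal
  rw [← h.map_toNat_boxCount hb, lintegral_map (measurable_of_countable _)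
    (h.measurable_toNat_boxCount b), ENNReal.coe_toNNReal hb] at h1
  rw [← h1]
  refine lintegral_congr_ae ?_
  filter_upwards [h.ae_boxCount_ne_top hb] with ω hω
  conv_lhs => rw [← ENat.natCast_toNat hω]
  rfl

lemma ae_tsum_lt_top (h : IsPoissonProcess P Λ μ) (hμ : ∀ b, boxMass μ b ≠ ∞)
    {c : ℕ × ℕ → ℝ≥0∞} (hc : ∑' b, c b * boxMass μ b ≠ ∞) :
    ∀ᵐ ω ∂P, ∑' b, c b * ((Λ ω).boxCount b : ℝ≥0∞) < ∞ := by
  have hm : ∀ b, Measurable fun ω => ((Λ ω).boxCount b : ℝ≥0∞) := fun b =>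
    (measurable_of_countable fun m : ℕ∞ => (m : ℝ≥0∞)).comp (h.measurable_boxCount b)
  refine ae_lt_top (Measurable.tsum fun b => (hm b).const_mul (c b)) ?_
  rw [lintegral_tsum fun b => ((hm b).const_mul (c b)).aemeasurable]
  simp_rw [lintegral_const_mul _ (hm _), h.lintegral_boxCount (hμ _)]
  exact hc

lemma lintegral_prod_pow (h : IsPoissonProcess P Λ μ) (hμ : ∀ b, boxMass μ b ≠ ∞)
    (F : Finset (ℕ × ℕ)) (x : ℕ × ℕ → NNReal) :
    ∫⁻ ω, ∏ b ∈ F, (x b : ℝ≥0∞) ^ ((Λ ω).boxCount b).toNat ∂P =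
      ENNReal.ofReal (Real.exp (∑ b ∈ F, (boxMass μ b).toReal * (x b - 1))) := by
  have hg : ∀ b, Measurable fun m : ℕ∞ => (x b : ℝ≥0∞) ^ m.toNat := fun b =>
    measurable_of_countable _
  rw [lintegral_prod_eq_prod_lintegral_of_indepFun F
    (fun b ω => (x b : ℝ≥0∞) ^ ((Λ ω).boxCount b).toNat) (h.iIndepFun_boxCount.comp _ hg)
    (fun b => (hg b).comp (h.measurable_boxCount b)), Real.exp_sum,
    ENNReal.ofReal_prod_of_nonneg fun _ _ => (Real.exp_pos _).le]
  refine Finset.prod_congr rfl fun b _ => ?_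
  have h1 := lintegral_pow_poissonMeasure (boxMass μ b).toNNReal (x b)
  rw [← h.map_toNat_boxCount (hμ b),
    lintegral_map (measurable_of_countable _) (h.measurable_toNat_boxCount b)] at h1
  exact h1

lemma ae_sum_mul_boxCount_eq (h : IsPoissonProcess P Λ μ) (hμ : ∀ b, boxMass μ b ≠ ∞)
    {c : ℕ × ℕ → ℝ≥0∞} (hc : ∀ b, c b ≠ ∞) (F : Finset (ℕ × ℕ)) :
    ∀ᵐ ω ∂P, ∑ b ∈ F, c b * ((Λ ω).boxCount b : ℝ≥0∞) =
      ENNReal.ofReal (∑ b ∈ F, (c b).toReal * ((Λ ω).boxCount b).toNat) := by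
  filter_upwards [ae_all_iff.2 fun b => h.ae_boxCount_ne_top (hμ b)] with ω hω
  rw [ENNReal.ofReal_sum_of_nonneg fun _ _ => by positivity]
  refine Finset.sum_congr rfl fun b _ => ?_
  rw [ENNReal.ofReal_mul ENNReal.toReal_nonneg, ENNReal.ofReal_toReal (hc b),
    ENNReal.ofReal_natCast]
  congr 1
  conv_lhs => rw [← ENat.natCast_toNat (hω b)]
  rfl

/-- Chernoff's bound for a weighted sum of finitely many dyadic counts. -/
lemma measure_lt_sum_le (h : IsPoissonProcess P Λ μ) (hμ : ∀ b, boxMass μ b ≠ ∞)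
    {c : ℕ × ℕ → ℝ≥0∞} (hc : ∀ b, c b ≤ 1) {C y : ℝ} (hC : 0 < C) (hy : 0 < y)
    (F : Finset (ℕ × ℕ)) (hF : ∑ b ∈ F, c b * boxMass μ b ≤ ENNReal.ofReal y) :
    P {ω | ENNReal.ofReal C < ∑ b ∈ F, c b * ((Λ ω).boxCount b : ℝ≥0∞)} ≤
      ENNReal.ofReal (Real.exp 1 * y ^ C) := by
  have hc' : ∀ b, c b ≠ ∞ := fun b => ne_top_of_le_ne_top ENNReal.one_ne_top (hc b)
  have hc1 : ∀ b, (c b).toReal ≤ 1 := fun b => ENNReal.toReal_le_of_le_ofReal zero_le_one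
    (by simpa using hc b)
  -- Markov's inequality is applied to `x^(∑ c_b N_b)`. This `x` keeps the exponent of the
  -- expectation at most 1, while `xy ≥ 1` turns `x^(-C)` into at most `y^C`.
  set x : NNReal := ⟨1 + 1 / y, by positivity⟩ with hx
  have hx1 : (x : ℝ) = 1 + 1 / y := rfl
  have hx0 : 1 ≤ (x : ℝ) := by rw [hx1]; linarith [one_div_pos.2 hy]
  have hxpos : 0 < (x : ℝ) := by linarith
  have hsum : ∑ b ∈ F, (c b).toReal * (boxMass μ b).toReal ≤ y := by
    have := ENNReal.toReal_le_of_le_ofReal hy.le hF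
    rw [ENNReal.toReal_sum fun b _ => ENNReal.mul_ne_top (hc' b) (hμ b)] at this
    simpa only [ENNReal.toReal_mul] using this
  have hexp : ∑ b ∈ F, (boxMass μ b).toReal * (((x ^ (c b).toReal : NNReal) : ℝ) - 1) ≤ 1 := by
    calc _ ≤ ∑ b ∈ F, (c b).toReal * (boxMass μ b).toReal * (1 / y) := by
          refine Finset.sum_le_sum fun b _ => ?_
          -- Bernoulli's inequality `(1 + 1/y)^c ≤ 1 + c/y`, valid because `0 ≤ c ≤ 1`.
          have h1 := rpow_one_add_le_one_add_mul_self (s := 1 / y)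
            (by linarith [one_div_pos.2 hy]) (p := (c b).toReal) ENNReal.toReal_nonneg (hc1 b)
          rw [NNReal.coe_rpow, hx1]
          have h2 : (0 : ℝ) ≤ (boxMass μ b).toReal := ENNReal.toReal_nonneg
          nlinarith
      _ = (∑ b ∈ F, (c b).toReal * (boxMass μ b).toReal) * (1 / y) := by rw [Finset.sum_mul]
      _ ≤ y * (1 / y) := by gcongr
      _ = 1 := mul_one_div_cancel hy.ne'
  have hint := h.lintegral_prod_pow hμ F fun b => x ^ (c b).toReal
  have hmeas : Measurable fun ω =>
      ∏ b ∈ F, ((x ^ (c b).toReal : NNReal) : ℝ≥0∞) ^ ((Λ ω).boxCount b).toNat :=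
    Finset.measurable_fun_prod F fun b _ =>
      (measurable_of_countable fun k : ℕ => ((x ^ (c b).toReal : NNReal) : ℝ≥0∞) ^ k).comp
        (h.measurable_toNat_boxCount b)
  have hmarkov := mul_meas_ge_le_lintegral (μ := P) hmeas (ENNReal.ofReal ((x : ℝ) ^ C))
  have hle : P {ω | ENNReal.ofReal C < ∑ b ∈ F, c b * ((Λ ω).boxCount b : ℝ≥0∞)} ≤
      P {ω | ENNReal.ofReal ((x : ℝ) ^ C) ≤
        ∏ b ∈ F, ((x ^ (c b).toReal : NNReal) : ℝ≥0∞) ^ ((Λ ω).boxCount b).toNat} := by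
    refine measure_mono_ae ?_
    filter_upwards [h.ae_sum_mul_boxCount_eq hμ hc' F] with ω hω hlt
    change ENNReal.ofReal C < ∑ b ∈ F, c b * ((Λ ω).boxCount b : ℝ≥0∞) at hlt
    change ENNReal.ofReal ((x : ℝ) ^ C) ≤ _
    rw [hω] at hlt
    have hlt' := (ENNReal.ofReal_lt_ofReal_iff_of_nonneg hC.le).1 hlt
    have h1 : ∏ b ∈ F, ((x ^ (c b).toReal : NNReal) : ℝ≥0∞) ^ ((Λ ω).boxCount b).toNat =
        ENNReal.ofReal ((x : ℝ) ^ (∑ b ∈ F, (c b).toReal * ((Λ ω).boxCount b).toNat)) := by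
      rw [Real.rpow_sum_of_pos hxpos, ENNReal.ofReal_prod_of_nonneg fun _ _ => by positivity]
      refine Finset.prod_congr rfl fun b _ => ?_
      rw [Real.rpow_mul hxpos.le, Real.rpow_natCast, ENNReal.ofReal_pow (by positivity),
        ← NNReal.coe_rpow, ENNReal.ofReal_coe_nnreal]
    rw [h1]
    exact ENNReal.ofReal_le_ofReal (Real.rpow_le_rpow_of_exponent_le hx0 hlt'.le)
  have hxC : 0 < (x : ℝ) ^ C := Real.rpow_pos_of_pos hxpos C
  have hfin : ENNReal.ofReal ((x : ℝ) ^ C) *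
      P {ω | ENNReal.ofReal C < ∑ b ∈ F, c b * ((Λ ω).boxCount b : ℝ≥0∞)} ≤
        ENNReal.ofReal (Real.exp 1) := by
    refine (mul_le_mul_right hle _).trans (hmarkov.trans ?_)
    rw [hint]
    exact ENNReal.ofReal_le_ofReal (Real.exp_le_exp.2 hexp)
  have hyx : 1 ≤ ENNReal.ofReal (y ^ C) * ENNReal.ofReal ((x : ℝ) ^ C) := by
    rw [← ENNReal.ofReal_mul (by positivity), ← Real.mul_rpow hy.le hxpos.le, ENNReal.one_le_ofReal]
    refine Real.one_le_rpow ?_ hC.le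
    rw [hx1, mul_add, mul_one_div_cancel hy.ne']
    linarith
  calc _ ≤ (ENNReal.ofReal (y ^ C) * ENNReal.ofReal ((x : ℝ) ^ C)) * P {ω | ENNReal.ofReal C <
        ∑ b ∈ F, c b * ((Λ ω).boxCount b : ℝ≥0∞)} := le_mul_of_one_le_left' hyx
    _ ≤ ENNReal.ofReal (y ^ C) * ENNReal.ofReal (Real.exp 1) := by
        rw [mul_assoc]; gcongr
    _ = _ := by rw [mul_comm, ENNReal.ofReal_mul (Real.exp_pos _).le]

/-- Chernoff's bound for a weighted sum of dyadic counts. -/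
lemma measure_lt_tsum_le (h : IsPoissonProcess P Λ μ) (hμ : ∀ b, boxMass μ b ≠ ∞)
    {c : ℕ × ℕ → ℝ≥0∞} (hc : ∀ b, c b ≤ 1) {C : ℝ} (hC : 0 < C) :
    P {ω | ENNReal.ofReal C < ∑' b, c b * ((Λ ω).boxCount b : ℝ≥0∞)} ≤
      ENNReal.ofReal (Real.exp 1) * (∑' b, c b * boxMass μ b) ^ C := by
  rcases eq_or_ne (∑' b, c b * boxMass μ b) ∞ with htop | htop
  · rw [htop, ENNReal.top_rpow_of_pos hC, ENNReal.mul_top (by simp [Real.exp_pos])]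
    exact le_top
  refine measure_lt_tsum_le_of_finset c _ _ fun F => ?_
  set Y := ∑' b, c b * boxMass μ b
  -- The finite bound needs `y > 0`, so it is used for all `y > Y` and `y` decreases to `Y`; this
  -- includes `Y = 0`.
  have hY : ∀ y : ℝ, Y.toReal < y →
      P {ω | ENNReal.ofReal C < ∑ b ∈ F, c b * ((Λ ω).boxCount b : ℝ≥0∞)} ≤
        ENNReal.ofReal (Real.exp 1 * y ^ C) := fun y hy =>
    h.measure_lt_sum_le hμ hc hC (ENNReal.toReal_nonneg.trans_lt hy) F
      ((ENNReal.sum_le_tsum F).trans ((ENNReal.le_ofReal_iff_toReal_le htop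
        (ENNReal.toReal_nonneg.trans hy.le)).2 hy.le))
  have hlim : Filter.Tendsto (fun y : ℝ => ENNReal.ofReal (Real.exp 1 * y ^ C))
      (nhdsWithin Y.toReal (Set.Ioi Y.toReal))
      (nhds (ENNReal.ofReal (Real.exp 1 * Y.toReal ^ C))) := by
    refine ENNReal.tendsto_ofReal (Filter.Tendsto.const_mul _ ?_)
    exact ((Real.continuousAt_rpow_const _ _ (Or.inr hC.le)).tendsto).mono_left nhdsWithin_le_nhds
  have := ge_of_tendsto hlim (Filter.eventually_of_mem self_mem_nhdsWithin hY)
  rwa [ENNReal.ofReal_mul (Real.exp_pos _).le, ← ENNReal.ofReal_rpow_of_nonneg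
    ENNReal.toReal_nonneg hC.le, ENNReal.ofReal_toReal htop] at this

end IsPoissonProcess

/-! ### A summability criterion for the Carleson condition -/

lemma windowWeight_le_one {q : ℝ≥0∞} (hq : q ≤ 1) (b c : ℕ × ℕ) : windowWeight q b c ≤ 1 := by
  rw [windowWeight]
  split_ifs
  · exact pow_le_one₀ zero_le hq
  · exact zero_le_one

lemma half_rpow_le_one {α : ℝ} (hα : 0 < α) : (2⁻¹ : ℝ≥0∞) ^ α ≤ 1 :=
  ENNReal.rpow_le_one (ENNReal.inv_le_one.2 one_le_two) hα.le

lemma half_rpow_lt_one {α : ℝ} (hα : 0 < α) : (2⁻¹ : ℝ≥0∞) ^ α < 1 :=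
  ENNReal.rpow_lt_one (ENNReal.inv_lt_one.2 ENNReal.one_lt_two) hα

lemma inv_one_sub_ne_top {q : ℝ≥0∞} (hq : q < 1) : (1 - q)⁻¹ ≠ ∞ :=
  ENNReal.inv_ne_top.2 (tsub_pos_of_lt hq).ne'

/-- `C` is both the threshold and the Chernoff exponent. By Borel–Cantelli almost surely only
finitely many window sums exceed `C`, and these are finite because their means are; hence all are
bounded together. -/
theorem IsPoissonProcess.ae_isCarleson {Ω : Type u} [MeasurableSpace Ω] {P : Measure Ω}
    [IsProbabilityMeasure P] {Λ : Ω → PointSeq} {μ : Measure Disc} (h : IsPoissonProcess P Λ μ)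
    (hμ : ∀ b, boxMass μ b ≠ ∞) {α C : ℝ} (hα : 0 < α) (hC : 0 < C)
    (hsum : ∑' b, (∑' c, windowWeight ((2⁻¹ : ℝ≥0∞) ^ α) b c * boxMass μ c) ^ C ≠ ∞) :
    ∀ᵐ ω ∂P, (Λ ω).IsCarleson α := by
  have hw := fun b c => windowWeight_le_one (half_rpow_le_one hα) b c
  have hfin := fun b => h.ae_tsum_lt_top hμ (c := windowWeight ((2⁻¹ : ℝ≥0∞) ^ α) b) (by
    intro htop
    refine ENNReal.ne_top_of_tsum_ne_top hsum b ?_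
    rw [htop, ENNReal.top_rpow_of_pos hC])
  have hbc : ∑' b, P {ω | ENNReal.ofReal C < (Λ ω).windowSum ((2⁻¹ : ℝ≥0∞) ^ α) b} ≠ ∞ := by
    refine ne_top_of_le_ne_top (ENNReal.mul_ne_top ENNReal.ofReal_ne_top hsum)
      ((ENNReal.tsum_le_tsum fun b => h.measure_lt_tsum_le hμ (hw b) hC).trans_eq
        ENNReal.tsum_mul_left)
  filter_upwards [ae_finite_setOfPred_mem hbc, ae_all_iff.2 hfin] with ω hω1 hω2
  have hle : ∀ b, (Λ ω).windowSum ((2⁻¹ : ℝ≥0∞) ^ α) b ≤ ENNReal.ofReal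
      (C + ∑ b ∈ hω1.toFinset, ((Λ ω).windowSum ((2⁻¹ : ℝ≥0∞) ^ α) b).toReal) := by
    intro b
    have h0 : ∀ b ∈ hω1.toFinset, 0 ≤ ((Λ ω).windowSum ((2⁻¹ : ℝ≥0∞) ^ α) b).toReal :=
      fun _ _ => ENNReal.toReal_nonneg
    by_cases hb : b ∈ hω1.toFinset
    · refine (ENNReal.le_ofReal_iff_toReal_le (hω2 b).ne (add_nonneg hC.le
        (Finset.sum_nonneg h0))).2 ?_
      have := Finset.single_le_sum h0 hb
      exact this.trans (by linarith)
    · rw [Set.Finite.mem_toFinset] at hb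
      refine (not_lt.1 hb).trans (ENNReal.ofReal_le_ofReal ?_)
      linarith [Finset.sum_nonneg h0]
  refine (Λ ω).isCarleson_of_windowSum_le hα ?_ hle
  exact add_nonneg hC.le (Finset.sum_nonneg fun _ _ => ENNReal.toReal_nonneg)

/-! ### The dyadic Hardy-type inequality -/

/-- There are at most `2^l` boxes `l` levels below `b`, whence a geometric series of ratio `2p`.
When `2p ≥ 1` the right-hand side is `∞`. -/
lemma tsum_windowWeight_le (p : ℝ≥0∞) (b : ℕ × ℕ) :
    ∑' c, windowWeight p b c ≤ (1 - 2 * p)⁻¹ := by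
  obtain ⟨n, k⟩ := b
  rw [ENNReal.tsum_prod', ← ENNReal.tsum_geometric,
    ← ENNReal.summable.sum_add_tsum_nat_add' (k := n) ]
  rw [Finset.sum_eq_zero, zero_add]
  · refine ENNReal.tsum_le_tsum fun l => ?_
    have h1 : ∀ i ∉ Finset.Ico (k * 2 ^ l) ((k + 1) * 2 ^ l),
        windowWeight p (n, k) (l + n, i) = 0 := by
      intro i hi
      rw [windowWeight, if_neg]
      rintro ⟨-, h2⟩
      simp only [Nat.add_sub_cancel] at h2
      refine hi (Finset.mem_Ico.2 ?_)
      rw [Nat.div_eq_iff (by positivity)] at h2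
      rw [add_mul]
      have : 0 < 2 ^ l := by positivity
      omega
    rw [tsum_eq_sum h1]
    calc _ ≤ ∑ i ∈ Finset.Ico (k * 2 ^ l) ((k + 1) * 2 ^ l), p ^ l := by
          refine Finset.sum_le_sum fun i _ => ?_
          rw [windowWeight]
          split_ifs
          · simp
          · exact zero_le
      _ = (2 * p) ^ l := by
          rw [Finset.sum_const, Nat.card_Ico, add_mul, one_mul, Nat.add_sub_cancel_left,
            nsmul_eq_mul, mul_pow]
          push_cast
          rfl
  · intro m hm
    rw [ENNReal.tsum_eq_zero]
    intro i
    rw [windowWeight, if_neg]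
    rintro ⟨h1, -⟩
    exact absurd (Finset.mem_range.1 hm) (not_lt.2 h1)

/-- A box has at most one ancestor per level, so no factor 2 appears here. -/
lemma tsum_windowWeight_ancestors_le (s : ℝ≥0∞) (c : ℕ × ℕ) :
    ∑' b, windowWeight s b c ≤ (1 - s)⁻¹ := by
  obtain ⟨m, i⟩ := c
  rw [ENNReal.tsum_prod', ← ENNReal.tsum_geometric]
  have h1 : ∀ n, ∑' k, windowWeight s (n, k) (m, i) ≤ if n ≤ m then s ^ (m - n) else 0 := by
    intro n
    rw [tsum_eq_single (i / 2 ^ (m - n))]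
    · rw [windowWeight]
      by_cases h : n ≤ m
      · rw [if_pos h]
        split_ifs
        · exact le_rfl
        · exact zero_le
      · rw [if_neg h, if_neg]
        exact fun h2 => h h2.1
    · intro k hk
      rw [windowWeight, if_neg]
      exact fun h2 => hk h2.2.symm
  calc _ ≤ ∑' n, if n ≤ m then s ^ (m - n) else 0 := ENNReal.tsum_le_tsum h1
    _ = ∑ n ∈ Finset.range (m + 1), s ^ (m + 1 - 1 - n) := by
        rw [tsum_eq_sum (s := Finset.range (m + 1))]
        · refine Finset.sum_congr rfl fun n hn => ?_
          rw [if_pos (by simpa [Nat.lt_succ_iff] using hn), Nat.add_sub_cancel]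
        · intro n hn
          rw [if_neg (by simpa [Nat.lt_succ_iff] using hn)]
    _ = ∑ n ∈ Finset.range (m + 1), s ^ n := Finset.sum_range_reflect (fun n => s ^ n) (m + 1)
    _ ≤ _ := ENNReal.sum_le_tsum _

lemma ENNReal.tsum_mul_rpow_le {ι : Type*} (w f : ι → ℝ≥0∞) {γ : ℝ} (hγ : 1 ≤ γ) :
    (∑' i, w i * f i) ^ γ ≤ (∑' i, w i) ^ (γ - 1) * ∑' i, w i * f i ^ γ := by
  have hγ0 : 0 < γ := by linarith
  have h : ∑' i, w i * f i ≤ (∑' i, w i) ^ (1 - γ⁻¹) * (∑' i, w i * f i ^ γ) ^ γ⁻¹ := by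
    rw [ENNReal.tsum_eq_iSup_sum]
    refine iSup_le fun F => (ENNReal.inner_le_weight_mul_Lp_of_nonneg F hγ w f).trans ?_
    have : 0 ≤ 1 - γ⁻¹ := sub_nonneg.2 (inv_le_one_of_one_le₀ hγ)
    gcongr
    · exact ENNReal.sum_le_tsum F
    · exact ENNReal.sum_le_tsum F
  calc _ ≤ ((∑' i, w i) ^ (1 - γ⁻¹) * (∑' i, w i * f i ^ γ) ^ γ⁻¹) ^ γ := by gcongr
    _ = _ := by
      rw [ENNReal.mul_rpow_of_nonneg _ _ hγ0.le, ← ENNReal.rpow_mul, ← ENNReal.rpow_mul,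
        inv_mul_cancel₀ hγ0.ne', ENNReal.rpow_one, sub_mul, inv_mul_cancel₀ hγ0.ne', one_mul]

lemma half_rpow_add (a b : ℝ) :
    (2⁻¹ : ℝ≥0∞) ^ (a + b) = (2⁻¹ : ℝ≥0∞) ^ a * (2⁻¹ : ℝ≥0∞) ^ b :=
  ENNReal.rpow_add a b (by simp) (by simp)

/-- Write `2^(-α) = p t` with `p = 2^(-(1+ε))`. The weights `p^l` are summable over descendants, so
Hölder moves the power `γ` inside at a bounded cost. The remaining weight has ratio `p t^γ = 2^(-δ)`
and, after exchanging sums, is summed over ancestors. The hypothesis `(1 - α)γ < 1` is what leaves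
room for `ε > 0` and `δ > 0`. -/
theorem tsum_windowMass_rpow_ne_top {α γ : ℝ} (hγ : 1 < γ) (hαγ : (1 - α) * γ < 1)
    (m : ℕ × ℕ → ℝ≥0∞) (hm : ∑' c, m c ^ γ ≠ ∞) :
    ∑' b, (∑' c, windowWeight ((2⁻¹ : ℝ≥0∞) ^ α) b c * m c) ^ γ ≠ ∞ := by
  obtain ⟨ε, hε, hεlt⟩ : ∃ ε : ℝ, 0 < ε ∧ (1 - α) * γ + ε * (γ - 1) < 1 := by
    -- Chosen so that `ε(γ - 1)` is half of the slack `1 - (1 - α)γ`.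
    refine ⟨(1 - (1 - α) * γ) / (2 * (γ - 1)), div_pos (by linarith) (by linarith), ?_⟩
    have h1 : γ - 1 ≠ 0 := by linarith
    have h2 : (1 - (1 - α) * γ) / (2 * (γ - 1)) * (γ - 1) = (1 - (1 - α) * γ) / 2 := by field_simp
    linarith
  set δ := 1 - ((1 - α) * γ + ε * (γ - 1)) with hδ
  have hδ0 : 0 < δ := by linarith
  set p : ℝ≥0∞ := 2⁻¹ ^ (1 + ε) with hp
  set t : ℝ≥0∞ := 2⁻¹ ^ (α - (1 + ε)) with ht
  have hq : (2⁻¹ : ℝ≥0∞) ^ α = p * t := by rw [hp, ht, ← half_rpow_add]; congr 1; ring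
  have hs : p * t ^ γ = 2⁻¹ ^ δ := by
    rw [hp, ht, ← ENNReal.rpow_mul, ← half_rpow_add]; congr 1; rw [hδ]; ring
  have h2p : 2 * p = 2⁻¹ ^ ε := by
    rw [hp, half_rpow_add, ENNReal.rpow_one, ← mul_assoc,
      ENNReal.mul_inv_cancel two_ne_zero ENNReal.ofNat_ne_top, one_mul]
  have hfac : ∀ b c, windowWeight ((2⁻¹ : ℝ≥0∞) ^ α) b c * m c =
      windowWeight p b c * (t ^ (c.1 - b.1) * m c) := by
    intro b c
    simp only [windowWeight]
    split_ifs
    · rw [hq, mul_pow, mul_assoc]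
    · simp
  have hcomm : ∀ (y : ℝ≥0∞) (k : ℕ), (y ^ k) ^ γ = (y ^ γ) ^ k := fun y k => by
    rw [← ENNReal.rpow_natCast, ← ENNReal.rpow_natCast, ← ENNReal.rpow_mul, ← ENNReal.rpow_mul,
      mul_comm]
  have hpow : ∀ b c, windowWeight p b c * (t ^ (c.1 - b.1) * m c) ^ γ =
      windowWeight (2⁻¹ ^ δ) b c * m c ^ γ := by
    intro b c
    simp only [windowWeight]
    split_ifs
    · rw [← hs, mul_pow, ENNReal.mul_rpow_of_nonneg _ _ (by linarith), mul_assoc, hcomm]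
    · simp
  have hstep : ∀ b, (∑' c, windowWeight ((2⁻¹ : ℝ≥0∞) ^ α) b c * m c) ^ γ ≤
      ((1 - 2⁻¹ ^ ε)⁻¹) ^ (γ - 1) * ∑' c, windowWeight (2⁻¹ ^ δ) b c * m c ^ γ := by
    intro b
    simp_rw [hfac, ← hpow]
    refine (ENNReal.tsum_mul_rpow_le _ _ hγ.le).trans ?_
    have : 0 ≤ γ - 1 := by linarith
    rw [← h2p]
    gcongr
    exact tsum_windowWeight_le p b
  refine ne_top_of_le_ne_top ?_ (ENNReal.tsum_le_tsum hstep)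
  rw [ENNReal.tsum_mul_left, ENNReal.tsum_comm]
  refine ENNReal.mul_ne_top (ENNReal.rpow_ne_top_of_nonneg (by linarith)
    (inv_one_sub_ne_top (half_rpow_lt_one hε))) ?_
  simp_rw [ENNReal.tsum_mul_right]
  refine ne_top_of_le_ne_top (ENNReal.mul_ne_top (inv_one_sub_ne_top (half_rpow_lt_one hδ0)) hm) ?_
  rw [← ENNReal.tsum_mul_left]
  gcongr
  exact tsum_windowWeight_ancestors_le _ _

/-! ### Lower bounds for the number of points -/

lemma poissonMeasure_singleton_mul_le (r : NNReal) {k M : ℕ} (hk : k < M) :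
    poissonMeasure r {k} * (((2 * M : ℕ) ^ M : ℝ≥0∞)⁻¹ * (r : ℝ≥0∞) ^ M) ≤
      poissonMeasure r {k + M} := by
  have hM : 0 < 2 * M := by omega
  have hfac : (k + M).factorial ≤ k.factorial * (2 * M) ^ M := by
    rw [← Nat.factorial_mul_ascFactorial]
    refine Nat.mul_le_mul_left _ ((Nat.ascFactorial_le_pow_add k M).trans ?_)
    exact Nat.pow_le_pow_left (by omega) M
  have hfac' : ((k + M).factorial : ℝ) ≤ k.factorial * ((2 * M : ℕ) : ℝ) ^ M := by
    exact_mod_cast hfac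
  have hconv : ((2 * M : ℕ) ^ M : ℝ≥0∞)⁻¹ * (r : ℝ≥0∞) ^ M =
      ENNReal.ofReal ((((2 * M : ℕ) : ℝ) ^ M)⁻¹ * (r : ℝ) ^ M) := by
    rw [ENNReal.ofReal_mul (by positivity), ENNReal.ofReal_inv_of_pos (by positivity),
      ENNReal.ofReal_pow (by positivity), ENNReal.ofReal_pow (by positivity),
      ENNReal.ofReal_natCast, ENNReal.ofReal_coe_nnreal]
  rw [hconv, poissonMeasure_singleton, poissonMeasure_singleton,
    ← ENNReal.ofReal_mul (by positivity)]
  refine ENNReal.ofReal_le_ofReal ?_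
  have : Real.exp (-r) * (r : ℝ) ^ k / k.factorial * ((((2 * M : ℕ) : ℝ) ^ M)⁻¹ * (r : ℝ) ^ M) =
      Real.exp (-r) * (r : ℝ) ^ (k + M) / (k.factorial * ((2 * M : ℕ) : ℝ) ^ M) := by
    rw [pow_add]; field_simp
  rw [this]
  gcongr

/-- The shift `k ↦ k + M` maps `{k < M}` injectively into its complement and costs at most the
factor of `poissonMeasure_singleton_mul_le`. The bound holds for every `r`, large or small. -/
lemma poissonMeasure_Iio_mul_le_one (r : NNReal) (M : ℕ) :
    poissonMeasure r (Set.Iio M) * (1 + ((2 * M : ℕ) ^ M : ℝ≥0∞)⁻¹ * (r : ℝ≥0∞) ^ M) ≤ 1 := by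
  have h1 : poissonMeasure r (Set.Iio M) * (((2 * M : ℕ) ^ M : ℝ≥0∞)⁻¹ * (r : ℝ≥0∞) ^ M) ≤
      poissonMeasure r (Set.Iio M)ᶜ := by
    rw [← Finset.coe_range, ← sum_measure_singleton, Finset.sum_mul]
    refine (Finset.sum_le_sum fun k hk =>
      poissonMeasure_singleton_mul_le r (Finset.mem_range.1 hk)).trans ?_
    rw [← Finset.sum_image (s := Finset.range M) (g := fun k => k + M)
      (f := fun k => poissonMeasure r {k}) (by intro a _ b _ h; simpa using h),
      sum_measure_singleton]
    refine measure_mono fun j hj => ?_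
    simp only [Finset.coe_image, Finset.coe_range, Set.mem_image, Set.mem_Iio] at hj
    obtain ⟨k, -, rfl⟩ := hj
    simp
  rw [mul_add, mul_one]
  refine (add_le_add_right h1 _).trans_eq ?_
  rw [measure_add_measure_compl measurableSet_Iio, measure_univ]

lemma sum_le_prod_one_add {ι : Type*} (F : Finset ι) (f : ι → ℝ≥0∞) :
    1 + ∑ i ∈ F, f i ≤ ∏ i ∈ F, (1 + f i) := by
  classical
  induction F using Finset.induction_on with
  | empty => simp
  | insert a s ha ih =>
    rw [Finset.sum_insert ha, Finset.prod_insert ha]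
    calc 1 + (f a + ∑ i ∈ s, f i) ≤ 1 + (f a + ∑ i ∈ s, f i) + f a * ∑ i ∈ s, f i := le_self_add
      _ = (1 + f a) * (1 + ∑ i ∈ s, f i) := by ring
      _ ≤ _ := by gcongr

/-- Shows an event of probability `x` to be null: it is enough to bound `x` times the partial sums
of a divergent series. -/
lemma eq_zero_of_mul_sum_le {ι : Type*} {f : ι → ℝ≥0∞} (hf : ∑' i, f i = ∞) {x B : ℝ≥0∞}
    (hB : B ≠ ∞) (h : ∀ F : Finset ι, x * ∑ i ∈ F, f i ≤ B) : x = 0 := by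
  by_contra hx
  have h1 : x * ∑' i, f i ≤ B := by
    rw [ENNReal.tsum_eq_iSup_sum, ENNReal.mul_iSup]
    exact iSup_le h
  rw [hf, ENNReal.mul_top hx] at h1
  exact hB (top_le_iff.1 h1)

namespace IsPoissonProcess

variable {Ω : Type u} [MeasurableSpace Ω] {P : Measure Ω} [IsProbabilityMeasure P]
  {Λ : Ω → PointSeq} {μ : Measure Disc}

lemma measure_forall_toNat_lt (h : IsPoissonProcess P Λ μ) (hμ : ∀ b, boxMass μ b ≠ ∞) (M : ℕ)
    (F : Finset (ℕ × ℕ)) :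
    P {ω | ∀ b ∈ F, ((Λ ω).boxCount b).toNat < M} =
      ∏ b ∈ F, poissonMeasure (boxMass μ b).toNNReal (Set.Iio M) := by
  have h1 := h.iIndepFun_boxCount.measure_inter_preimage_eq_mul F
    (sets := fun _ => {m : ℕ∞ | m.toNat < M}) (fun _ _ => Set.to_countable _ |>.measurableSet)
  have h2 : {ω | ∀ b ∈ F, ((Λ ω).boxCount b).toNat < M} =
      ⋂ b ∈ F, (fun ω => (Λ ω).boxCount b) ⁻¹' {m : ℕ∞ | m.toNat < M} := by
    ext ω; simp
  rw [h2, h1]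
  refine Finset.prod_congr rfl fun b _ => ?_
  rw [← h.map_toNat_boxCount (hμ b), Measure.map_apply (h.measurable_toNat_boxCount b)
    measurableSet_Iio]
  rfl

/-- If the `M`-th powers of the intensities of a family of boxes have infinite sum, then almost
surely one of these boxes holds at least `M` points. -/
lemma ae_exists_le_boxCount (h : IsPoissonProcess P Λ μ) (hμ : ∀ b, boxMass μ b ≠ ∞) (M : ℕ)
    (S : Set (ℕ × ℕ)) (hS : ∑' b : S, boxMass μ b ^ M = ∞) :
    ∀ᵐ ω ∂P, ∃ b ∈ S, (M : ℕ∞) ≤ (Λ ω).boxCount b := by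
  have hzero : P {ω | ∀ b ∈ S, ((Λ ω).boxCount b).toNat < M} = 0 := by
    have hc : ((2 * M : ℕ) ^ M : ℝ≥0∞)⁻¹ ≠ 0 :=
      ENNReal.inv_ne_zero.2 (ENNReal.pow_ne_top (ENNReal.natCast_ne_top _))
    refine eq_zero_of_mul_sum_le (f := fun b : S => ((2 * M : ℕ) ^ M : ℝ≥0∞)⁻¹ * boxMass μ b ^ M)
      (by rw [ENNReal.tsum_mul_left, hS, ENNReal.mul_top hc]) ENNReal.one_ne_top fun F => ?_
    set G := F.map (Function.Embedding.subtype _) with hG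
    have hsum : ∑ b ∈ F, ((2 * M : ℕ) ^ M : ℝ≥0∞)⁻¹ * boxMass μ b ^ M =
        ∑ b ∈ G, ((2 * M : ℕ) ^ M : ℝ≥0∞)⁻¹ * boxMass μ b ^ M := by
      rw [hG, Finset.sum_map]; rfl
    -- By independence the probability is at most a product of factors `P(N_b < M)`, each at most
    -- `1/(1 + c μ_b^M)`; the product of the denominators dominates `c ∑ μ_b^M`.
    have hle : P {ω | ∀ b ∈ S, ((Λ ω).boxCount b).toNat < M} ≤
        ∏ b ∈ G, poissonMeasure (boxMass μ b).toNNReal (Set.Iio M) := by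
      rw [← h.measure_forall_toNat_lt hμ]
      refine measure_mono fun ω hω b hb => hω b ?_
      obtain ⟨a, -, rfl⟩ := Finset.mem_map.1 hb
      exact a.2
    rw [hsum]
    calc _ ≤ (∏ b ∈ G, poissonMeasure (boxMass μ b).toNNReal (Set.Iio M)) *
          ∏ b ∈ G, (1 + ((2 * M : ℕ) ^ M : ℝ≥0∞)⁻¹ * boxMass μ b ^ M) := by
          gcongr
          exact le_add_self.trans (sum_le_prod_one_add G _)
      _ = ∏ b ∈ G, (poissonMeasure (boxMass μ b).toNNReal (Set.Iio M) *
          (1 + ((2 * M : ℕ) ^ M : ℝ≥0∞)⁻¹ * boxMass μ b ^ M)) := Finset.prod_mul_distrib.symm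
      _ ≤ 1 := Finset.prod_le_one' fun b _ => by
          have := poissonMeasure_Iio_mul_le_one (boxMass μ b).toNNReal M
          rwa [ENNReal.coe_toNNReal (hμ b)] at this
  filter_upwards [measure_eq_zero_iff_ae_notMem.1 hzero,
    ae_all_iff.2 fun b => h.ae_boxCount_ne_top (hμ b)] with ω hω hfin
  simp only [not_forall, not_lt] at hω
  obtain ⟨b, hb, hM⟩ := hω
  refine ⟨b, hb, ?_⟩
  rw [← ENat.natCast_toNat (hfin b)]
  exact_mod_cast hM

/-- A weighted sum of dyadic counts with infinite mean is almost surely infinite. -/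
lemma ae_tsum_eq_top (h : IsPoissonProcess P Λ μ) (hμ : ∀ b, boxMass μ b ≠ ∞)
    {c : ℕ × ℕ → ℝ≥0∞} (hc : ∀ b, c b ≤ 1) (hsum : ∑' b, c b * boxMass μ b = ∞) :
    ∀ᵐ ω ∂P, ∑' b, c b * ((Λ ω).boxCount b : ℝ≥0∞) = ∞ := by
  have hc' : ∀ b, c b ≠ ∞ := fun b => ne_top_of_le_ne_top ENNReal.one_ne_top (hc b)
  have hc1 : ∀ b, (c b).toReal ≤ 1 := fun b => ENNReal.toReal_le_of_le_ofReal zero_le_one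
    (by simpa using hc b)
  have key : ∀ K : ℕ, P {ω | ∑' b, c b * ((Λ ω).boxCount b : ℝ≥0∞) ≤ (K : ℝ≥0∞)} = 0 := by
    intro K
    -- With `T` the mean of the partial sum, Markov applied to `exp(-∑ c_b N_b)` gives probability
    -- at most `e^K e^(-T/2)`, and `T e^(-T/2) ≤ 2`.
    refine eq_zero_of_mul_sum_le hsum (B := ENNReal.ofReal (Real.exp K * 2))
      ENNReal.ofReal_ne_top fun F => ?_
    set x : ℕ × ℕ → NNReal := fun b => ⟨Real.exp (-(c b).toReal), (Real.exp_pos _).le⟩ with hx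
    have hxv : ∀ b, (x b : ℝ) = Real.exp (-(c b).toReal) := fun _ => rfl
    set T := ∑ b ∈ F, (c b).toReal * (boxMass μ b).toReal with hT
    have hT0 : 0 ≤ T := Finset.sum_nonneg fun _ _ => by positivity
    have hTeq : ∑ b ∈ F, c b * boxMass μ b = ENNReal.ofReal T := by
      rw [hT, ENNReal.ofReal_sum_of_nonneg fun _ _ => by positivity]
      refine Finset.sum_congr rfl fun b _ => ?_
      rw [ENNReal.ofReal_mul ENNReal.toReal_nonneg, ENNReal.ofReal_toReal (hc' b),
        ENNReal.ofReal_toReal (hμ b)]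
    have hexp : ∑ b ∈ F, (boxMass μ b).toReal * ((x b : ℝ) - 1) ≤ -(T / 2) := by
      rw [hT, Finset.sum_div, ← Finset.sum_neg_distrib]
      refine Finset.sum_le_sum fun b _ => ?_
      have h0 : 0 ≤ (c b).toReal := ENNReal.toReal_nonneg
      -- The inequality `e^(-s) ≤ 1 - s/2` on `[0, 1]`, where `c b ≤ 1` enters.
      have h2 : (x b : ℝ) ≤ 1 - (c b).toReal / 2 := by
        rw [hxv, Real.exp_neg, inv_le_iff_one_le_mul₀ (Real.exp_pos _)]
        nlinarith [Real.add_one_le_exp (c b).toReal, hc1 b]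
      have h3 : 0 ≤ (boxMass μ b).toReal := ENNReal.toReal_nonneg
      nlinarith
    have hint := h.lintegral_prod_pow hμ F x
    have hmeas : Measurable fun ω => ∏ b ∈ F, (x b : ℝ≥0∞) ^ ((Λ ω).boxCount b).toNat :=
      Finset.measurable_fun_prod F fun b _ =>
        (measurable_of_countable fun k : ℕ => (x b : ℝ≥0∞) ^ k).comp
          (h.measurable_toNat_boxCount b)
    have hmarkov := mul_meas_ge_le_lintegral (μ := P) hmeas (ENNReal.ofReal (Real.exp (-K)))
    have hle : P {ω | ∑' b, c b * ((Λ ω).boxCount b : ℝ≥0∞) ≤ (K : ℝ≥0∞)} ≤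
        P {ω | ENNReal.ofReal (Real.exp (-K)) ≤
          ∏ b ∈ F, (x b : ℝ≥0∞) ^ ((Λ ω).boxCount b).toNat} := by
      refine measure_mono_ae ?_
      filter_upwards [h.ae_sum_mul_boxCount_eq hμ hc' F] with ω hω hlt
      change ∑' b, c b * ((Λ ω).boxCount b : ℝ≥0∞) ≤ (K : ℝ≥0∞) at hlt
      change ENNReal.ofReal (Real.exp (-K)) ≤ _
      have h1 := (ENNReal.sum_le_tsum F).trans hlt
      rw [hω, ← ENNReal.ofReal_natCast, ENNReal.ofReal_le_ofReal_iff (Nat.cast_nonneg K)] at h1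
      have h2 : ∏ b ∈ F, (x b : ℝ≥0∞) ^ ((Λ ω).boxCount b).toNat =
          ENNReal.ofReal (Real.exp (-∑ b ∈ F, (c b).toReal * ((Λ ω).boxCount b).toNat)) := by
        rw [← Finset.sum_neg_distrib, Real.exp_sum,
          ENNReal.ofReal_prod_of_nonneg fun _ _ => (Real.exp_pos _).le]
        refine Finset.prod_congr rfl fun b _ => ?_
        rw [← neg_mul, mul_comm, Real.exp_nat_mul, ENNReal.ofReal_pow (Real.exp_pos _).le, ← hxv,
          ENNReal.ofReal_coe_nnreal]
      rw [h2]
      exact ENNReal.ofReal_le_ofReal (Real.exp_le_exp.2 (neg_le_neg h1))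
    have hfin : ENNReal.ofReal (Real.exp (-K)) *
        P {ω | ∑' b, c b * ((Λ ω).boxCount b : ℝ≥0∞) ≤ (K : ℝ≥0∞)} ≤
          ENNReal.ofReal (Real.exp (-(T / 2))) := by
      refine (mul_le_mul_right hle _).trans (hmarkov.trans ?_)
      rw [hint]
      exact ENNReal.ofReal_le_ofReal (Real.exp_le_exp.2 hexp)
    set p := P {ω | ∑' b, c b * ((Λ ω).boxCount b : ℝ≥0∞) ≤ (K : ℝ≥0∞)}
    have hT2 : Real.exp (-(T / 2)) * T ≤ 2 := by
      rw [Real.exp_neg, inv_mul_le_iff₀ (Real.exp_pos _)]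
      nlinarith [Real.add_one_le_exp (T / 2)]
    calc p * ∑ b ∈ F, c b * boxMass μ b
        = ENNReal.ofReal (Real.exp K) * (ENNReal.ofReal (Real.exp (-K)) * p) *
          ENNReal.ofReal T := by
          rw [hTeq, ← mul_assoc, ← ENNReal.ofReal_mul (Real.exp_pos _).le, ← Real.exp_add,
            add_neg_cancel, Real.exp_zero, ENNReal.ofReal_one, one_mul]
      _ ≤ ENNReal.ofReal (Real.exp K) * ENNReal.ofReal (Real.exp (-(T / 2))) *
          ENNReal.ofReal T := by gcongr
      _ = ENNReal.ofReal (Real.exp K * (Real.exp (-(T / 2)) * T)) := by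
          rw [← ENNReal.ofReal_mul (Real.exp_pos _).le, ← ENNReal.ofReal_mul (by positivity),
            mul_assoc]
      _ ≤ _ := ENNReal.ofReal_le_ofReal (by gcongr)
  filter_upwards [ae_all_iff.2 fun K => measure_eq_zero_iff_ae_notMem.1 (key K)] with ω hω
  by_contra hne
  obtain ⟨K, hK⟩ := ENNReal.exists_nat_gt hne
  exact hω K hK.le

end IsPoissonProcess

/-! ### Purely atomic intensities -/

/-- A point of the dyadic box with address `b`, if there is such a box. -/
noncomputable def boxPoint (b : ℕ × ℕ) : Disc :=
  ⟨((1 - (1 / 2 : ℝ) ^ b.1 : ℝ) : ℂ) * circlePoint (b.2 / 2 ^ b.1), by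
    have h1 : (0 : ℝ) < (1 / 2) ^ b.1 := by positivity
    have h2 : (1 / 2 : ℝ) ^ b.1 ≤ 1 := pow_le_one₀ (by norm_num) (by norm_num)
    rw [mem_ball_zero_iff, norm_mul, norm_circlePoint, Complex.norm_real, Real.norm_of_nonneg
      (by linarith)]
    linarith⟩

lemma norm_boxPoint (b : ℕ × ℕ) : ‖(boxPoint b : ℂ)‖ = 1 - (1 / 2 : ℝ) ^ b.1 := by
  have h2 : (1 / 2 : ℝ) ^ b.1 ≤ 1 := pow_le_one₀ (by norm_num) (by norm_num)
  rw [boxPoint, norm_mul, norm_circlePoint, Complex.norm_real, Real.norm_of_nonneg (by linarith),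
    mul_one]

lemma discCode_boxPoint {n k : ℕ} (hk : k < 2 ^ n) : discCode (boxPoint (n, k)) = (n, k) := by
  have hlev : discLevel (boxPoint (n, k)) = n := by
    rw [discLevel_eq_iff, norm_boxPoint, pow_succ]
    have h1 : (0 : ℝ) < (1 / 2) ^ n := by positivity
    constructor <;> linarith
  -- For `n = 0` the point is the origin, whose angle is not determined by the formula; there the
  -- address is forced by `k < 2^0`.
  rcases Nat.eq_zero_or_pos n with rfl | hn
  · obtain rfl : k = 0 := by simpa using hk
    refine Prod.ext hlev ?_
    have := discCode_snd_lt (boxPoint (0, 0))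
    rw [show (discCode (boxPoint (0, 0))).1 = 0 from hlev] at this
    omega
  · have h0 : (boxPoint (n, k) : ℂ) ≠ 0 := by
      rw [← norm_ne_zero_iff, norm_boxPoint]
      have : (1 / 2 : ℝ) ^ n < 1 := pow_lt_one₀ (by norm_num) (by norm_num) hn.ne'
      simp only
      linarith
    have h1 : (boxPoint (n, k) : ℂ) =
        (‖(boxPoint (n, k) : ℂ)‖ : ℂ) * circlePoint (k / 2 ^ n) := by
      rw [norm_boxPoint]; rfl
    have hk' : (k : ℝ) < 2 ^ n := by exact_mod_cast hk
    rw [discCode_eq_iff, discAngle_eq_fract h0 h1, Int.fract_eq_self.2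
      ⟨by positivity, by rwa [div_lt_one (by positivity)]⟩]
    refine ⟨hlev, le_rfl, ?_⟩
    gcongr
    linarith

/-- One atom per box. Local finiteness holds because a disc of radius less than 1 meets only
finitely many boxes. -/
lemma exists_measure_boxMass_eq (m : ℕ × ℕ → ℝ≥0∞) (hm : ∀ b, m b ≠ ∞)
    (hm0 : ∀ n k, 2 ^ n ≤ k → m (n, k) = 0) (hsum : ∑' b, m b = ∞) :
    ∃ μ : Measure Disc, SigmaFinite μ ∧ IsLocallyFiniteMeasure μ ∧ μ Set.univ = ∞ ∧
      boxMass μ = m := by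
  set μ : Measure Disc := Measure.sum fun b => m b • Measure.dirac (boxPoint b) with hμ
  have hbox : boxMass μ = m := by
    ext b
    rw [boxMass, hμ, Measure.sum_apply _ (measurableSet_discCode {b}), tsum_eq_single b]
    · rw [Measure.smul_apply, Measure.dirac_apply' _ (measurableSet_discCode {b}), smul_eq_mul]
      rcases lt_or_ge b.2 (2 ^ b.1) with h | h
      · rw [Set.indicator_of_mem (show boxPoint b ∈ discCode ⁻¹' {b} from discCode_boxPoint h),
          Pi.one_apply, mul_one]
      · rw [show m b = 0 from hm0 _ _ h, zero_mul]
    · intro c hc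
      rw [Measure.smul_apply, Measure.dirac_apply' _ (measurableSet_discCode {b}), smul_eq_mul]
      rcases lt_or_ge c.2 (2 ^ c.1) with h | h
      · rw [Set.indicator_of_notMem, mul_zero]
        intro hmem
        exact hc ((discCode_boxPoint h).symm.trans hmem)
      · rw [show m c = 0 from hm0 _ _ h, zero_mul]
  have hloc : IsLocallyFiniteMeasure μ := by
    refine ⟨fun z => ⟨{w | (1 / 2 : ℝ) ^ (discLevel z + 1) < 1 - ‖(w : ℂ)‖}, ?_, ?_⟩⟩
    · exact (isOpen_lt (by fun_prop) (by fun_prop)).mem_nhds (lt_one_sub_norm z)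
    · set F := Finset.range (discLevel z + 1) ×ˢ Finset.range (2 ^ discLevel z)
      have hsub : {w : Disc | (1 / 2 : ℝ) ^ (discLevel z + 1) < 1 - ‖(w : ℂ)‖} ⊆
          ⋃ b ∈ F, discCode ⁻¹' {b} := by
        intro w hw
        have h1 : (1 / 2 : ℝ) ^ (discLevel z + 1) < (1 / 2) ^ discLevel w :=
          lt_of_lt_of_le hw (one_sub_norm_le w)
        have h2 := (pow_lt_pow_iff_right_of_lt_one₀ (by norm_num : (0 : ℝ) < 1 / 2)
          (by norm_num)).1 h1
        have h3 : (discCode w).2 < 2 ^ discLevel z :=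
          (discCode_snd_lt w).trans_le (Nat.pow_le_pow_right two_pos (Nat.lt_succ_iff.1 h2))
        exact Set.mem_biUnion (x := discCode w)
          (Finset.mem_product.2 ⟨Finset.mem_range.2 h2, Finset.mem_range.2 h3⟩) rfl
      refine (measure_mono hsub).trans_lt ((measure_biUnion_finset_le F _).trans_lt ?_)
      refine ENNReal.sum_lt_top.2 fun b _ => ?_
      change boxMass μ b < ∞
      rw [hbox]
      exact (hm b).lt_top
  refine ⟨μ, inferInstance, hloc, ?_, hbox⟩
  rw [hμ, Measure.sum_apply _ MeasurableSet.univ, ← hsum]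
  exact tsum_congr fun b => by simp

/-! ### Series -/

lemma tsum_inv_nat_rpow_ne_top {s : ℝ} (hs : 1 < s) :
    ∑' n : ℕ, (((n + 1 : ℕ) : ℝ≥0∞)⁻¹) ^ s ≠ ∞ := by
  have h := (summable_nat_add_iff 1).2 (Real.summable_nat_rpow_inv.2 hs)
  have h2 : ∀ n : ℕ, (((n + 1 : ℕ) : ℝ≥0∞)⁻¹) ^ s =
      ENNReal.ofReal ((((n + 1 : ℕ) : ℝ) ^ s)⁻¹) := fun n => by
    rw [ENNReal.ofReal_inv_of_pos (by positivity), ← ENNReal.ofReal_rpow_of_pos (by positivity),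
      ENNReal.ofReal_natCast, ENNReal.inv_rpow]
  simp_rw [h2]
  rw [← ENNReal.ofReal_tsum_of_nonneg (fun n => by positivity) h]
  exact ENNReal.ofReal_ne_top

lemma tsum_inv_nat_eq_top : ∑' n : ℕ, ((n + 1 : ℕ) : ℝ≥0∞)⁻¹ = ∞ := by
  by_contra h
  refine Real.not_summable_natCast_inv ((summable_nat_add_iff 1).1 ?_)
  have := ENNReal.summable_toReal h
  simpa only [ENNReal.toReal_inv, ENNReal.toReal_natCast] using this

lemma tsum_inv_nat_rpow_eq_top {s : ℝ} (hs : s ≤ 1) :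
    ∑' n : ℕ, (((n + 1 : ℕ) : ℝ≥0∞)⁻¹) ^ s = ∞ := by
  refine top_le_iff.1 (tsum_inv_nat_eq_top.symm.le.trans (ENNReal.tsum_le_tsum fun n => ?_))
  have h1 : ((n + 1 : ℕ) : ℝ≥0∞)⁻¹ ≤ 1 :=
    ENNReal.inv_le_one.2 (by exact_mod_cast Nat.le_add_left 1 n)
  simpa using ENNReal.rpow_le_rpow_of_exponent_ge h1 hs

/-! ### Violating the Carleson condition -/

lemma isArc_image_Icc (a : ℝ) {l : ℝ} (h0 : 0 ≤ l) (h1 : l ≤ 1) :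
    IsArc (circlePoint '' Set.Icc a (a + l)) l :=
  ⟨h0, h1, a, _, Set.Ioo_subset_Icc_self, subset_rfl, rfl⟩

lemma mem_carlesonWindow {z : Disc} {a l : ℝ} (h1 : 1 - l < ‖(z : ℂ)‖)
    (h2 : discAngle z ∈ Set.Icc a (a + l)) :
    z ∈ carlesonWindow (circlePoint '' Set.Icc a (a + l)) l :=
  ⟨h1, _, ⟨_, h2, rfl⟩, disc_eq_norm_mul_circlePoint z⟩

/-- The window of the full circle has finite weight for a Carleson sequence. It omits the origin,
hence the restriction to levels at least 1. -/
lemma PointSeq.not_isCarleson_of_tsum_eq_top (Λ : PointSeq) {α : ℝ} (hα : 0 < α)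
    (h : ∑' b, ({b | 1 ≤ b.1} : Set (ℕ × ℕ)).indicator
      (fun b => ((2⁻¹ : ℝ≥0∞) ^ α) ^ (b.1 + 1)) b * (Λ.boxCount b : ℝ≥0∞) = ∞) :
    ¬ Λ.IsCarleson α := by
  rintro ⟨C, -, hC⟩
  have h1 := hC _ 1 (isArc_image_Icc 0 zero_le_one le_rfl)
  have h2 := Λ.le_weight hα (carlesonWindow (circlePoint '' Set.Icc 0 (0 + 1)) 1)
    ({b | 1 ≤ b.1} : Set (ℕ × ℕ)) (by
      intro z hz
      refine mem_carlesonWindow ?_ ⟨discAngle_nonneg z, by linarith [discAngle_lt_one z]⟩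
      have h3 := one_sub_norm_le z
      have h4 : (1 / 2 : ℝ) ^ discLevel z < 1 :=
        pow_lt_one₀ (by norm_num) (by norm_num) (Nat.one_le_iff_ne_zero.1 hz)
      linarith)
  simp_rw [Set.indicator_mul_left, h] at h2
  exact ENNReal.ofReal_ne_top (top_le_iff.1 (h2.trans h1))

/-- A box of level `j + 1` lies in a window of length `2^(-j)`, and each of its points weighs at
least `2^(-(j+2))`; the ratio is 4. -/
lemma PointSeq.boxCount_le_of_isCarleson (Λ : PointSeq) {C : ℝ} (hC0 : 0 < C)
    (hC : ∀ (I : Set ℂ) (l : ℝ), IsArc I l →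
      Λ.weight 1 (carlesonWindow I l) ≤ ENNReal.ofReal (C * l ^ (1 : ℝ)))
    {b : ℕ × ℕ} (hb : 1 ≤ b.1) : (Λ.boxCount b : ℝ≥0∞) ≤ ENNReal.ofReal (4 * C) := by
  obtain ⟨n, k⟩ := b
  obtain ⟨j, rfl⟩ : ∃ j, n = j + 1 := ⟨n - 1, by simp only at hb; omega⟩
  have hpos : (0 : ℝ) < (1 / 2) ^ j := by positivity
  have h1 := hC _ ((1 / 2) ^ j) (isArc_image_Icc ((k : ℝ) / 2 ^ (j + 1)) hpos.le
    (pow_le_one₀ (by norm_num) (by norm_num)))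
  have h2 := Λ.le_weight one_pos _ {(j + 1, k)} (fun z hz => by
    have hz' := (discCode_eq_iff z (j + 1) k).1 hz
    refine mem_carlesonWindow (a := (k : ℝ) / 2 ^ (j + 1)) (l := (1 / 2) ^ j) ?_ ⟨hz'.2.1, ?_⟩
    · have h3 := one_sub_norm_le z
      rw [hz'.1, pow_succ] at h3
      linarith
    · refine hz'.2.2.le.trans ?_
      rw [add_div]
      gcongr
      rw [← one_div_pow]
      exact pow_le_pow_of_le_one (by norm_num) (by norm_num) (Nat.le_succ j))
  have h3 := (ENNReal.le_tsum ((j + 1, k) : ℕ × ℕ)).trans (h2.trans h1)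
  rw [Set.indicator_of_mem (Set.mem_singleton _), Real.rpow_one, ← ofReal_half_pow_rpow _ one_pos,
    Real.rpow_one] at h3
  have h4 : (0 : ℝ) < (1 / 2) ^ (j + 1 + 1) := by positivity
  rw [mul_comm, ← ENNReal.le_div_iff_mul_le (Or.inl (by simp))
    (Or.inl ENNReal.ofReal_ne_top), ← ENNReal.ofReal_div_of_pos h4] at h3
  refine h3.trans (ENNReal.ofReal_le_ofReal (le_of_eq ?_))
  rw [pow_succ, pow_succ]
  field_simp
  norm_num

theorem IsPoissonProcess.ae_not_isCarleson_one {Ω : Type u} [MeasurableSpace Ω] {P : Measure Ω}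
    [IsProbabilityMeasure P] {Λ : Ω → PointSeq} {μ : Measure Disc} (h : IsPoissonProcess P Λ μ)
    (hμ : ∀ b, boxMass μ b ≠ ∞) (hsum : ∀ γ : ℝ, 1 < γ → dyadicSum μ γ = ∞) :
    ∀ᵐ ω ∂P, ¬ (Λ ω).IsCarleson 1 := by
  set S : Set (ℕ × ℕ) := {b | 1 ≤ b.1} with hS
  -- The exponent `M + 2` exceeds 1, and discarding level 0 removes a single finite term.
  have hdiv : ∀ M : ℕ, ∑' b : S, boxMass μ b ^ (M + 2) = ∞ := by
    intro M
    by_contra hne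
    have h1 := hsum ((M + 2 : ℕ) : ℝ) (by push_cast; linarith [(Nat.cast_nonneg M : (0 : ℝ) ≤ M)])
    rw [dyadicSum_eq_tsum μ (by positivity)] at h1
    simp_rw [ENNReal.rpow_natCast] at h1
    rw [← Summable.tsum_add_tsum_compl (s := S) ENNReal.summable ENNReal.summable] at h1
    have h2 : ∑' b : ↑Sᶜ, boxMass μ b ^ (M + 2) ≠ ∞ := by
      rw [tsum_subtype Sᶜ (fun b => boxMass μ b ^ (M + 2)), tsum_eq_single (0, 0)]
      · rw [Set.indicator_of_mem (by simp [hS])]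
        exact ENNReal.pow_ne_top (hμ _)
      · rintro ⟨n, k⟩ hnk
        by_cases hn : n = 0
        · subst hn
          have hk : 2 ^ 0 ≤ k := by
            rw [pow_zero, Nat.one_le_iff_ne_zero]
            rintro rfl
            exact hnk rfl
          rw [Set.indicator_apply, boxMass_eq_zero μ hk]
          simp
        · rw [Set.indicator_of_notMem]
          simpa [hS, Nat.one_le_iff_ne_zero] using hn
    exact ENNReal.add_ne_top.2 ⟨hne, h2⟩ h1
  filter_upwards [ae_all_iff.2 fun M => h.ae_exists_le_boxCount hμ (M + 2) S (hdiv M)] with ω hω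
  rintro ⟨C, hC0, hC⟩
  obtain ⟨M, hM⟩ := exists_nat_gt (4 * C)
  obtain ⟨b, hb, hMb⟩ := hω M
  have h1 := (Λ ω).boxCount_le_of_isCarleson hC0 hC hb
  have h2 : ((M + 2 : ℕ) : ℝ≥0∞) ≤ ((Λ ω).boxCount b : ℝ≥0∞) := by
    exact_mod_cast ENat.toENNReal_le.2 hMb
  have h3 := h2.trans h1
  rw [← ENNReal.ofReal_natCast, ENNReal.ofReal_le_ofReal_iff (by positivity)] at h3
  push_cast at h3
  linarith

/-! ### The intensities of parts (c) and (d) -/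

lemma tsum_ite_le_sub (n : ℕ) (f : ℕ → ℝ≥0∞) :
    ∑' j, (if n ≤ j then f (j - n) else 0) = ∑' l, f l := by
  rw [← ENNReal.summable.sum_add_tsum_nat_add' (k := n), Finset.sum_eq_zero, zero_add]
  · exact tsum_congr fun l => by simp
  · intro j hj
    rw [if_neg (not_le.2 (Finset.mem_range.1 hj))]

lemma tsum_eq_tsum_two_pow_mul (v : ℕ → ℝ≥0∞) :
    ∑' b : ℕ × ℕ, (if b.2 < 2 ^ b.1 then v b.1 else 0) = ∑' n, 2 ^ n * v n := by
  rw [tsum_eq_tsum_sum_fin fun n k hk => if_neg (not_lt.2 hk)]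
  refine tsum_congr fun n => ?_
  simp

theorem exists_measure_not_isCarleson {α : ℝ} (hα : 0 < α) (hα1 : α < 1) :
    ∃ μ : Measure Disc, SigmaFinite μ ∧ IsLocallyFiniteMeasure μ ∧ μ Set.univ = ∞ ∧
      dyadicSum μ (1 / (1 - α)) < ∞ ∧
      ∀ (Ω : Type u) [MeasurableSpace Ω] (P : Measure Ω) [IsProbabilityMeasure P]
        (Λ : Ω → PointSeq), IsPoissonProcess P Λ μ → ∀ᵐ ω ∂P, ¬ (Λ ω).IsCarleson α := by
  have hγ : 0 < 1 / (1 - α) := one_div_pos.2 (by linarith)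
  have hγ1 : 1 < 1 / (1 - α) := by rw [one_lt_div (by linarith)]; linarith
  -- Level `n` has `2^n` boxes: the mean weight is of order `∑ 1/(n+1) = ∞`, but the power `1/(1-α)`
  -- of the masses sums to `∑ (n+1)^(-1/(1-α)) < ∞`.
  set v : ℕ → ℝ≥0∞ := fun n => ((2⁻¹ : ℝ≥0∞) ^ (1 - α)) ^ n * ((n + 1 : ℕ) : ℝ≥0∞)⁻¹ with hv
  set m : ℕ × ℕ → ℝ≥0∞ := fun b => if b.2 < 2 ^ b.1 then v b.1 else 0 with hm
  set c : ℕ × ℕ → ℝ≥0∞ := ({b | 1 ≤ b.1} : Set (ℕ × ℕ)).indicator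
      (fun b => ((2⁻¹ : ℝ≥0∞) ^ α) ^ (b.1 + 1)) with hc
  have hc1 : ∀ b, c b ≤ 1 := fun b => Set.indicator_apply_le'
    (fun _ => pow_le_one₀ zero_le (half_rpow_le_one hα)) fun _ => zero_le_one
  have h2n : ∀ n : ℕ, (2 : ℝ≥0∞) ^ n * 2⁻¹ ^ n = 1 := fun n => by
    rw [← mul_pow, ENNReal.mul_inv_cancel two_ne_zero ENNReal.ofNat_ne_top, one_pow]
  have hcm : ∑' b, c b * m b = ∞ := by
    have h1 : ∀ b, c b * m b = if b.2 < 2 ^ b.1 then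
        (if 1 ≤ b.1 then ((2⁻¹ : ℝ≥0∞) ^ α) ^ (b.1 + 1) else 0) * v b.1 else 0 := by
      intro b
      simp only [hc, hm, Set.indicator_apply, Set.mem_ofPred_eq, mul_ite, mul_zero]
    simp_rw [h1]
    rw [tsum_eq_tsum_two_pow_mul (fun n =>
      (if 1 ≤ n then ((2⁻¹ : ℝ≥0∞) ^ α) ^ (n + 1) else 0) * v n),
      tsum_eq_zero_add' ENNReal.summable]
    have h2 : ∀ n : ℕ, (2 : ℝ≥0∞) ^ (n + 1) * ((if 1 ≤ n + 1 then
        ((2⁻¹ : ℝ≥0∞) ^ α) ^ (n + 1 + 1) else 0) * v (n + 1)) =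
        (2⁻¹ : ℝ≥0∞) ^ α * ((n + 1 + 1 : ℕ) : ℝ≥0∞)⁻¹ := by
      intro n
      rw [if_pos (by omega), hv]
      calc _ = ((2 : ℝ≥0∞) ^ (n + 1) *
            ((2⁻¹ : ℝ≥0∞) ^ α * (2⁻¹ : ℝ≥0∞) ^ (1 - α)) ^ (n + 1)) *
              ((2⁻¹ : ℝ≥0∞) ^ α * ((n + 1 + 1 : ℕ) : ℝ≥0∞)⁻¹) := by
            rw [mul_pow, pow_succ ((2⁻¹ : ℝ≥0∞) ^ α) (n + 1)]; ring
        _ = _ := by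
            rw [← half_rpow_add, add_sub_cancel, ENNReal.rpow_one, h2n, one_mul]
    simp_rw [h2]
    rw [ENNReal.tsum_mul_left]
    have h3 : ∑' n : ℕ, ((n + 1 + 1 : ℕ) : ℝ≥0∞)⁻¹ = ∞ := by
      by_contra hne
      have := tsum_inv_nat_eq_top
      rw [tsum_eq_zero_add' ENNReal.summable] at this
      exact ENNReal.add_ne_top.2 ⟨by simp, hne⟩ this
    rw [h3, ENNReal.mul_top (by simp), add_top]
  obtain ⟨μ, h1, h2, h3, h4⟩ := exists_measure_boxMass_eq m
    (fun b => by
      simp only [hm, hv]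
      split_ifs
      · exact ENNReal.mul_ne_top (ENNReal.pow_ne_top
          (ne_top_of_le_ne_top ENNReal.one_ne_top (half_rpow_le_one (by linarith)))) (by simp)
      · simp)
    (fun n k hk => if_neg (not_lt.2 hk))
    (top_le_iff.1 (hcm.symm.le.trans (ENNReal.tsum_le_tsum fun b =>
      mul_le_of_le_one_left' (hc1 b))))
  refine ⟨μ, h1, h2, h3, ?_, ?_⟩
  · have h5 : ∀ b, m b ^ (1 / (1 - α)) = if b.2 < 2 ^ b.1 then
        2⁻¹ ^ b.1 * (((b.1 + 1 : ℕ) : ℝ≥0∞)⁻¹) ^ (1 / (1 - α)) else 0 := by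
      intro b
      simp only [hm, hv]
      split_ifs
      · rw [ENNReal.mul_rpow_of_nonneg _ _ hγ.le, ← ENNReal.rpow_natCast, ← ENNReal.rpow_mul,
          ← ENNReal.rpow_mul, ← ENNReal.rpow_natCast]
        congr 2
        have : 1 - α ≠ 0 := by linarith
        field_simp
      · exact ENNReal.zero_rpow_of_pos hγ
    rw [dyadicSum_eq_tsum μ hγ, h4]
    simp_rw [h5]
    rw [tsum_eq_tsum_two_pow_mul (fun n => 2⁻¹ ^ n * (((n + 1 : ℕ) : ℝ≥0∞)⁻¹) ^ (1 / (1 - α)))]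
    simp_rw [← mul_assoc, h2n, one_mul]
    exact (tsum_inv_nat_rpow_ne_top hγ1).lt_top
  · intro Ω _ P _ Λ hΛ
    have h6 := hΛ.ae_tsum_eq_top (fun b => (boxMass_lt_top μ b).ne) hc1 (by rw [h4, hcm])
    filter_upwards [h6] with ω hω
    exact (Λ ω).not_isCarleson_of_tsum_eq_top hα hω

theorem exists_measure_isCarleson {γ : ℝ} (hγ : 1 < γ) :
    ∃ μ : Measure Disc, SigmaFinite μ ∧ IsLocallyFiniteMeasure μ ∧ μ Set.univ = ∞ ∧
      dyadicSum μ γ = ∞ ∧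
      ∀ α : ℝ, 0 < α → α < 1 →
        ∀ (Ω : Type u) [MeasurableSpace Ω] (P : Measure Ω) [IsProbabilityMeasure P]
          (Λ : Ω → PointSeq), IsPoissonProcess P Λ μ → ∀ᵐ ω ∂P, (Λ ω).IsCarleson α := by
  have hγ0 : 0 < γ := by linarith
  set v : ℕ → ℝ≥0∞ := fun n => (((n + 1 : ℕ) : ℝ≥0∞)⁻¹) ^ (1 / γ) with hv
  have hvanti : Antitone v := fun i j hij => by
    simp only [hv]
    gcongr
  set m : ℕ × ℕ → ℝ≥0∞ := fun b => if b.2 = 0 then v b.1 else 0 with hm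
  have hcol : ∀ w : ℕ → ℝ≥0∞, ∑' b : ℕ × ℕ, (if b.2 = 0 then w b.1 else 0) = ∑' n, w n := by
    intro w
    rw [ENNReal.tsum_prod']
    exact tsum_congr fun n => tsum_ite_eq 0 _
  obtain ⟨μ, h1, h2, h3, h4⟩ := exists_measure_boxMass_eq m
    (fun b => by
      simp only [hm, hv]
      split_ifs
      · exact ENNReal.rpow_ne_top_of_nonneg (by positivity) (by simp)
      · simp)
    (fun n k hk => if_neg (Nat.pos_iff_ne_zero.1 ((Nat.two_pow_pos n).trans_le hk)))
    (by
      rw [hcol]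
      exact tsum_inv_nat_rpow_eq_top (by rw [div_le_one hγ0]; exact hγ.le))
  refine ⟨μ, h1, h2, h3, ?_, ?_⟩
  · have h5 : ∀ b, m b ^ γ = if b.2 = 0 then ((b.1 + 1 : ℕ) : ℝ≥0∞)⁻¹ else 0 := by
      intro b
      simp only [hm, hv]
      split_ifs
      · rw [← ENNReal.rpow_mul, one_div_mul_cancel hγ0.ne', ENNReal.rpow_one]
      · exact ENNReal.zero_rpow_of_pos hγ0
    rw [dyadicSum_eq_tsum μ hγ0, h4]
    simp_rw [h5]
    rw [hcol fun n => ((n + 1 : ℕ) : ℝ≥0∞)⁻¹, tsum_inv_nat_eq_top]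
  · intro α hα _ Ω _ P _ Λ hΛ
    -- The exponent `2γ` turns `v n = (n+1)^(-1/γ)` into the summable `(n+1)^(-2)`.
    refine hΛ.ae_isCarleson (fun b => (boxMass_lt_top μ b).ne) hα (C := 2 * γ) (by positivity) ?_
    rw [h4]
    set q : ℝ≥0∞ := 2⁻¹ ^ α with hq
    -- Only windows with `k = 0` contain charged boxes, one per level, with masses at most `v n`
    -- since `v` decreases.
    have hY : ∀ b, ∑' c, windowWeight q b c * m c ≤
        if b.2 = 0 then (1 - q)⁻¹ * v b.1 else 0 := by
      rintro ⟨n, k⟩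
      have h6 : ∀ c : ℕ × ℕ, windowWeight q (n, k) c * m c ≤
          if c.2 = 0 then (if k = 0 then (if n ≤ c.1 then q ^ (c.1 - n) else 0) * v n else 0)
            else 0 := by
        rintro ⟨j, i⟩
        by_cases hi : i = 0
        · subst hi
          simp only [windowWeight, hm, dyadicBelow, Set.mem_ofPred_eq, if_true, Nat.zero_div]
          by_cases hk : k = 0
          · subst hk
            by_cases hn : n ≤ j
            · simp only [hn, and_self, if_true]
              gcongr
              exact hvanti hn
            · simp [hn]
          · simp [hk, Ne.symm hk]
        · simp [hm, hi]
      refine (ENNReal.tsum_le_tsum h6).trans ?_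
      rw [hcol fun j => if k = 0 then (if n ≤ j then q ^ (j - n) else 0) * v n else 0]
      simp only
      split_ifs
      · rw [ENNReal.tsum_mul_right, tsum_ite_le_sub n fun l => q ^ l, ENNReal.tsum_geometric]
      · simp
    have hY2 : ∀ b, (∑' c, windowWeight q b c * m c) ^ (2 * γ) ≤
        if b.2 = 0 then (1 - q)⁻¹ ^ (2 * γ) * (((b.1 + 1 : ℕ) : ℝ≥0∞)⁻¹) ^ (2 : ℝ) else 0 := by
      intro b
      refine (ENNReal.rpow_le_rpow (hY b) (by positivity)).trans (le_of_eq ?_)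
      split_ifs
      · rw [ENNReal.mul_rpow_of_nonneg _ _ (by positivity), hv, ← ENNReal.rpow_mul]
        congr 2
        field_simp
      · exact ENNReal.zero_rpow_of_pos (by positivity)
    refine ne_top_of_le_ne_top ?_ (ENNReal.tsum_le_tsum hY2)
    rw [hcol fun n => (1 - q)⁻¹ ^ (2 * γ) * (((n + 1 : ℕ) : ℝ≥0∞)⁻¹) ^ (2 : ℝ),
      ENNReal.tsum_mul_left]
    exact ENNReal.mul_ne_top (ENNReal.rpow_ne_top_of_nonneg (by positivity)
      (inv_one_sub_ne_top (half_rpow_lt_one hα))) (tsum_inv_nat_rpow_ne_top one_lt_two)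

/-! ### Assembly -/

theorem theorem2 :
    -- parts (a) and (b)
    (∀ (μ : Measure Disc) [SigmaFinite μ] [IsLocallyFiniteMeasure μ]
        (Ω : Type u) [MeasurableSpace Ω] (P : Measure Ω) [IsProbabilityMeasure P]
        (Λ : Ω → PointSeq), IsPoissonProcess P Λ μ →
      ((∃ γ : ℝ, 1 < γ ∧ dyadicSum μ γ < ∞) → ∀ᵐ ω ∂P, (Λ ω).IsCarleson 1) ∧
      ((∀ γ : ℝ, 1 < γ → dyadicSum μ γ = ∞) → ∀ᵐ ω ∂P, ¬ (Λ ω).IsCarleson 1) ∧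
      (∀ α : ℝ, 0 < α → α < 1 →
        (∃ γ : ℝ, 1 < γ ∧ γ < 1 / (1 - α) ∧ dyadicSum μ γ < ∞) →
          ∀ᵐ ω ∂P, (Λ ω).IsCarleson α)) ∧
    -- part (c)
    (∀ α : ℝ, 0 < α → α < 1 → ∃ μ : Measure Disc,
      SigmaFinite μ ∧ IsLocallyFiniteMeasure μ ∧ μ Set.univ = ∞ ∧
      dyadicSum μ (1 / (1 - α)) < ∞ ∧
      ∀ (Ω : Type u) [MeasurableSpace Ω] (P : Measure Ω) [IsProbabilityMeasure P]
        (Λ : Ω → PointSeq), IsPoissonProcess P Λ μ → ∀ᵐ ω ∂P, ¬ (Λ ω).IsCarleson α) ∧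
    -- part (d)
    (∀ γ : ℝ, 1 < γ → ∃ μ : Measure Disc,
      SigmaFinite μ ∧ IsLocallyFiniteMeasure μ ∧ μ Set.univ = ∞ ∧
      dyadicSum μ γ = ∞ ∧
      ∀ α : ℝ, 0 < α → α < 1 →
        ∀ (Ω : Type u) [MeasurableSpace Ω] (P : Measure Ω) [IsProbabilityMeasure P]
          (Λ : Ω → PointSeq), IsPoissonProcess P Λ μ → ∀ᵐ ω ∂P, (Λ ω).IsCarleson α) := by
  refine ⟨fun μ _ _ Ω _ P _ Λ hΛ => ?_, fun α hα hα1 => exists_measure_not_isCarleson hα hα1,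
    fun γ hγ => exists_measure_isCarleson hγ⟩
  have hμ : ∀ b, boxMass μ b ≠ ∞ := fun b => (boxMass_lt_top μ b).ne
  -- The criterion with `C = γ`. The condition `(1 - α)γ < 1` is automatic for `α = 1` and means `γ
  -- < 1/(1 - α)` for `α < 1`.
  have key : ∀ α γ : ℝ, 0 < α → 1 < γ → (1 - α) * γ < 1 → dyadicSum μ γ < ∞ →
      ∀ᵐ ω ∂P, (Λ ω).IsCarleson α := fun α γ hα hγ hαγ hsum =>
    hΛ.ae_isCarleson hμ hα (one_pos.trans hγ) (tsum_windowMass_rpow_ne_top hγ hαγ _ (by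
      rw [← dyadicSum_eq_tsum μ (one_pos.trans hγ)]
      exact hsum.ne))
  refine ⟨?_, hΛ.ae_not_isCarleson_one hμ, ?_⟩
  · rintro ⟨γ, hγ, hsum⟩
    exact key 1 γ one_pos hγ (by simp) hsum
  · rintro α hα hα1 ⟨γ, hγ, hγα, hsum⟩
    refine key α γ hα hγ ?_ hsum
    rwa [lt_div_iff₀ (by linarith), mul_comm] at hγα
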